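/- Let $I=[0,1]$, let $a\in L^1(I)$ be real-valued, and for $\lambda\in\mathbb R$ let $L[\lambda]u=u''+(a+\lambda)u$ for $u\in W^{2,1}(I)=\{u\in C^1(I): u'\in AC(I)\}$. Consider on $I$ the Neumann conditions $N$: $u'(0)=u'(1)=0$, the mixed conditions $M_1$: $u'(0)=u(1)=0$, and the mixed conditions $M_2$: $u(0)=u'(1)=0$. For $X\in\{N,M_1,M_2\}$, $L[\lambda]$ is called nonresonant for $X$ if the only $u\in W^{2,1}(I)$ with $L[\lambda]u=0$ a.e. on $I$ satisfying the conditions $X$ is $u\equiv0$; otherwise $\lambda$ is an eigenvalue of $X$. A Green's function $G_X[\lambda]$ is a continuous function on $I\times I$, $C^1$ off the diagonal, such that for each $s\in(0,1)$ the function $G_X[\lambda](\cdot,s)$ is of class $W^{2,1}$ and solves $L[\lambda]u=0$ a.e. on each of $[0,s]$ and $[s,1]$ and satisfies the conditions $X$, and such that for each $t\in(0,1)$ the lateral limits $\partial_tG(t^-,t)=\partial_tG(t,t^+)$ and $\partial_tG(t^+,t)=\partial_tG(t,t^-)$ exist and $\partial_tG(t^+,t)-\partial_tG(t^-,t)=1$.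 1. If $L[\lambda]$ is nonresonant for $X\in\{N,M_1,M_2\}$, then a Green's function $G_X[\lambda]$ exists. 2. If $L[\lambda]$ is nonresonant for $N$ and $M_2$, then for all $(t,s)\in I\times I$ $$G_{M_2}[\lambda](t,s)=G_N[\lambda](t,s)+G_N[\lambda](t,0)\,\partial_tG_{M_2}[\lambda](0,s),$$ where $s\mapsto \partial_tG_{M_2}[\lambda](0,s)$, defined for $s\in(0,1]$, is extended to $s=0$ by continuity. 3. If $L[\lambda]$ is nonresonant for $N$ and $M_1$, then for all $(t,s)\in I\times I$ $$G_{M_1}[\lambda](t,s)=G_N[\lambda](t,s)-G_N[\lambda](t,1)\,\partial_tG_{M_1}[\lambda](1,s),$$ where $s\mapsto \partial_tG_{M_1}[\lambda](1,s)$, defined for $s\in[0,1)$, is extended to $s=1$ by continuity. 4. There is a smallest Neumann eigenvalue $\lambda_0^N$. For every $\lambda<\lambda_0^N$, $L[\lambda]$ is nonresonant for $N$, $M_1$ and $M_2$, and $$G_N[\lambda](t,s)<G_{M_2}[\lambda](t,s)<0\quad\text{for all }(t,s)\in(0,1]\times(0,1],$$ $$G_N[\lambda](t,s)<G_{M_1}[\lambda](t,s)<0\quad\text{for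 all }(t,s)\in[0,1)\times[0,1).$$ -/

import Mathlib

open Set Filter Topology MeasureTheory

namespace HillGreen

/-- `u` belongs to the Sobolev space `W^{2,1}([c,d])`: `u` is differentiable on `[c,d]` (one-sided
derivatives at the end points) and its derivative is absolutely continuous on `[c,d]`. -/
def MemW21 (c d : ℝ) (u : ℝ → ℝ) : Prop :=
  DifferentiableOn ℝ u (Icc c d) ∧
    AbsolutelyContinuousOnInterval (derivWithin u (Icc c d)) c d

/-- The operator `L[lam] u = u'' + (a + lam) u` on the interval `[c,d]`, evaluated at `t`. -/
noncomputable def hillOp (a : ℝ → ℝ) (lam c d : ℝ) (u : ℝ → ℝ) (t : ℝ) : ℝ :=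
  derivWithin (derivWithin u (Icc c d)) (Icc c d) t + (a t + lam) * u t

/-- `u ∈ W^{2,1}([c,d])` and `L[lam] u = 0` almost everywhere on `[c,d]`. -/
def SolvesHill (a : ℝ → ℝ) (lam c d : ℝ) (u : ℝ → ℝ) : Prop :=
  MemW21 c d u ∧ ∀ᵐ t : ℝ, t ∈ Icc c d → hillOp a lam c d u t = 0

/-- The three kinds of boundary conditions on `[0,1]`. -/
inductive BoundaryCondition
  | neumann
  | mixed1
  | mixed2

/-- The boundary conditions: Neumann `u'(0) = u'(1) = 0`, Mixed 1 `u'(0) = u(1) = 0`,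
Mixed 2 `u(0) = u'(1) = 0`. -/
def BoundaryCondition.Holds : BoundaryCondition → (ℝ → ℝ) → Prop
  | .neumann, u => derivWithin u (Icc 0 1) 0 = 0 ∧ derivWithin u (Icc 0 1) 1 = 0
  | .mixed1, u => derivWithin u (Icc 0 1) 0 = 0 ∧ u 1 = 0
  | .mixed2, u => u 0 = 0 ∧ derivWithin u (Icc 0 1) 1 = 0

/-- `lam` is an eigenvalue: the homogeneous problem `L[lam] u = 0` has a solution in
`W^{2,1}([0,1])` satisfying the boundary conditions and not identically zero on `[0,1]`. -/
def IsEigenvalue (a : ℝ → ℝ) (bc : BoundaryCondition) (lam : ℝ) : Prop :=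
  ∃ u : ℝ → ℝ, SolvesHill a lam 0 1 u ∧ bc.Holds u ∧ ∃ t ∈ Icc (0 : ℝ) 1, u t ≠ 0

/-- `L[lam]` is nonresonant: the homogeneous problem has only the trivial solution. -/
def IsNonresonant (a : ℝ → ℝ) (bc : BoundaryCondition) (lam : ℝ) : Prop :=
  ∀ u : ℝ → ℝ, SolvesHill a lam 0 1 u → bc.Holds u → ∀ t ∈ Icc (0 : ℝ) 1, u t = 0

/-- `G` is a Green's function of `L[lam]` with the boundary conditions `bc` (its values outside
`[0,1] × [0,1]` are irrelevant). Since the potential is only integrable, regularity off the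
diagonal is `C¹`, together with `G(·,s) ∈ W^{2,1}` on either side of `s`. -/
structure IsGreenFunction (a : ℝ → ℝ) (bc : BoundaryCondition) (lam : ℝ) (G : ℝ → ℝ → ℝ) :
    Prop where
  continuousOn : ContinuousOn (Function.uncurry G) (Icc 0 1 ×ˢ Icc 0 1)
  contDiffOn : ContDiffOn ℝ 1 (Function.uncurry G)
    {p : ℝ × ℝ | p ∈ Icc (0 : ℝ) 1 ×ˢ Icc (0 : ℝ) 1 ∧ p.1 ≠ p.2}
  solves_left : ∀ s ∈ Ioo (0 : ℝ) 1, SolvesHill a lam 0 s (fun t => G t s)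
  solves_right : ∀ s ∈ Ioo (0 : ℝ) 1, SolvesHill a lam s 1 (fun t => G t s)
  boundary : ∀ s ∈ Ioo (0 : ℝ) 1, bc.Holds (fun t => G t s)
  /-- The lateral limits `∂ₜG(t⁻,t) = ∂ₜG(t,t⁺) = l` and `∂ₜG(t⁺,t) = ∂ₜG(t,t⁻) = r` exist, and
  the jump `r - l` is `1`. -/
  jump : ∀ t ∈ Ioo (0 : ℝ) 1, ∃ l r : ℝ,
    Tendsto (fun τ => deriv (fun x => G x t) τ) (𝓝[<] t) (𝓝 l) ∧
    Tendsto (fun s => deriv (fun x => G x s) t) (𝓝[>] t) (𝓝 l) ∧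
    Tendsto (fun τ => deriv (fun x => G x t) τ) (𝓝[>] t) (𝓝 r) ∧
    Tendsto (fun s => deriv (fun x => G x s) t) (𝓝[<] t) (𝓝 r) ∧
    r - l = 1

end HillGreen

/-! Let `m` be the mean of `a` and `A` the primitive of `a - m` vanishing at 0 and 1. With `p = u' +
A u` and `μ = lam + m`, the equation becomes a linear system with continuous coefficients, and the
boundary conditions on `u'` become conditions on `p`. `SolvesHill.isQuasiSol` and
`IsQuasiSol.solvesHill` make the translation; from there only classical calculus and constancy of
Wronskians are needed.

Every Green's function is `f (min t s) * g (max t s) / W`, with `f`, `g` solving the left and right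
conditions (`eq_green`, `isGreenFunction`). The Neumann and Mixed 2 kernels share `g`, the Neumann
and Mixed 1 kernels share `f`, so the identities are algebra.

The first eigenvalue is the supremum of `posSet A`, which is nonempty, bounded above and downward
closed. At the supremum the solution is still positive, so `p 1 > 0` would let the parameter
increase further; hence `p 1 = 0` (`exists_first_eigenvalue`). Below it, positivity of `u₁` and `p₁
1` fixes the sign of every factor of the kernels. -/

namespace HillGreen

/-! ### The first order system: Wronskians, existence, dependence on the parameter. -/

/-- `(u, p)` solves on `[c,d]` the first order system `u' = p - A u`, `p' = A p - (μ + A²) u`. If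
`A' = b`, it is equivalent to `u'' + (b + μ) u = 0`, with `p = u' + A u`. -/
structure IsQuasiSol (A : ℝ → ℝ) (μ c d : ℝ) (u p : ℝ → ℝ) : Prop where
  deriv_fst : ∀ t ∈ Icc c d, HasDerivWithinAt u (p t - A t * u t) (Icc c d) t
  deriv_snd : ∀ t ∈ Icc c d, HasDerivWithinAt p (A t * p t - (μ + A t ^ 2) * u t) (Icc c d) t

variable {A : ℝ → ℝ} {μ c d : ℝ} {u p v q : ℝ → ℝ}

namespace IsQuasiSol

lemma continuousOn_fst (h : IsQuasiSol A μ c d u p) : ContinuousOn u (Icc c d) :=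
  fun t ht => (h.deriv_fst t ht).continuousWithinAt

lemma continuousOn_snd (h : IsQuasiSol A μ c d u p) : ContinuousOn p (Icc c d) :=
  fun t ht => (h.deriv_snd t ht).continuousWithinAt

lemma mono (h : IsQuasiSol A μ c d u p) {c' d' : ℝ} (hs : Icc c' d' ⊆ Icc c d) :
    IsQuasiSol A μ c' d' u p :=
  ⟨fun t ht => (h.deriv_fst t (hs ht)).mono hs, fun t ht => (h.deriv_snd t (hs ht)).mono hs⟩

lemma lincomb (hu : IsQuasiSol A μ c d u p) (hv : IsQuasiSol A μ c d v q) (α β : ℝ) :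
    IsQuasiSol A μ c d (fun t => α * u t + β * v t) (fun t => α * p t + β * q t) := by
  constructor
  · intro t ht
    convert! ((hu.deriv_fst t ht).const_mul α).add ((hv.deriv_fst t ht).const_mul β) using 1
    ring
  · intro t ht
    convert! ((hu.deriv_snd t ht).const_mul α).add ((hv.deriv_snd t ht).const_mul β) using 1
    ring

/-- The matrix of the system has trace `-A + A = 0`. -/
lemma wronskian_eq (hu : IsQuasiSol A μ c d u p) (hv : IsQuasiSol A μ c d v q) :
    ∀ t ∈ Icc c d, u t * q t - v t * p t = u c * q c - v c * p c := by
  have key : ∀ t ∈ Icc c d, HasDerivWithinAt (fun t => u t * q t - v t * p t) 0 (Icc c d) t := by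
    intro t ht
    convert! ((hu.deriv_fst t ht).mul (hv.deriv_snd t ht)).sub
      ((hv.deriv_fst t ht).mul (hu.deriv_snd t ht)) using 1
    ring
  refine constant_of_derivWithin_zero (fun t ht => (key t ht).differentiableWithinAt) ?_
  intro t ht
  exact (key t (Ico_subset_Icc_self ht)).derivWithin
    (uniqueDiffOn_Icc (ht.1.trans_lt ht.2) t (Ico_subset_Icc_self ht))

lemma hasDerivAt_fst (h : IsQuasiSol A μ c d u p) {t : ℝ} (ht : t ∈ Ioo c d) :
    HasDerivAt u (p t - A t * u t) t :=
  (h.deriv_fst t (Ioo_subset_Icc_self ht)).hasDerivAt (Icc_mem_nhds ht.1 ht.2)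

lemma hasDerivAt_snd (h : IsQuasiSol A μ c d u p) {t : ℝ} (ht : t ∈ Ioo c d) :
    HasDerivAt p (A t * p t - (μ + A t ^ 2) * u t) t :=
  (h.deriv_snd t (Ioo_subset_Icc_self ht)).hasDerivAt (Icc_mem_nhds ht.1 ht.2)

lemma contDiffOn_fst (h : IsQuasiSol A μ c d u p) (hcd : c < d) (hA : ContinuousOn A (Icc c d)) :
    ContDiffOn ℝ 1 u (Icc c d) := by
  have hu := uniqueDiffOn_Icc hcd
  refine (contDiffOn_one_iff_derivWithin hu).2
    ⟨fun t ht => (h.deriv_fst t ht).differentiableWithinAt, ?_⟩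
  refine ContinuousOn.congr (h.continuousOn_snd.sub (hA.mul h.continuousOn_fst)) ?_
  exact fun t ht => (h.deriv_fst t ht).derivWithin (hu t ht)

lemma contDiffOn_snd (h : IsQuasiSol A μ c d u p) (hcd : c < d) (hA : ContinuousOn A (Icc c d)) :
    ContDiffOn ℝ 1 p (Icc c d) := by
  have hu := uniqueDiffOn_Icc hcd
  refine (contDiffOn_one_iff_derivWithin hu).2
    ⟨fun t ht => (h.deriv_snd t ht).differentiableWithinAt, ?_⟩
  refine ContinuousOn.congr ((hA.mul h.continuousOn_snd).sub
    ((continuousOn_const (c := μ) |>.add (hA.pow 2)).mul h.continuousOn_fst)) ?_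
  exact fun t ht => (h.deriv_snd t ht).derivWithin (hu t ht)

end IsQuasiSol

lemma hasDerivWithinAt_Ici_of_Icc {E : Type*} [NormedAddCommGroup E] [NormedSpace ℝ E]
    {f : ℝ → E} {f' : E} {t : ℝ} (ht : t ∈ Ico c d) (h : HasDerivWithinAt f f' (Icc c d) t) :
    HasDerivWithinAt f f' (Ici t) t :=
  h.mono_of_mem_nhdsWithin (mem_of_superset (Icc_mem_nhdsGE ht.2) (Icc_subset_Icc_left ht.1))

/-- Truncation of a real number to `[-R,R]`. -/
noncomputable def clip (R x : ℝ) : ℝ := max (-R) (min R x)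

lemma lipschitzWith_clip (R : ℝ) : LipschitzWith 1 (clip R) :=
  (LipschitzWith.id.const_min R).const_max (-R)

lemma abs_clip_sub_le (R x y : ℝ) : |clip R x - clip R y| ≤ |x - y| := by
  simpa [Real.dist_eq] using (lipschitzWith_clip R).dist_le_mul x y

lemma clip_of_abs_le {R x : ℝ} (h : |x| ≤ R) : clip R x = x := by
  rw [abs_le] at h
  simp [clip, h.1, h.2]

lemma abs_clip_le {R : ℝ} (hR : 0 ≤ R) (x : ℝ) : |clip R x| ≤ R :=
  abs_le.2 ⟨le_max_left _ _, max_le (by linarith) (min_le_left _ _)⟩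

lemma abs_clip_le_abs {R : ℝ} (hR : 0 ≤ R) (x : ℝ) : |clip R x| ≤ |x| := by
  have := abs_clip_sub_le R x 0
  rwa [clip_of_abs_le (x := 0) (by simpa using hR), sub_zero, sub_zero] at this

/-- The right hand side of the first order system. -/
def field (A : ℝ → ℝ) (μ t : ℝ) (x : ℝ × ℝ) : ℝ × ℝ :=
  (x.2 - A t * x.1, A t * x.2 - (μ + A t ^ 2) * x.1)

lemma norm_field_le {B t : ℝ} (hB : |A t| ≤ B) {x : ℝ × ℝ} {r : ℝ} (h1 : |x.1| ≤ r)
    (h2 : |x.2| ≤ r) : ‖field A μ t x‖ ≤ (1 + B + |μ| + B ^ 2) * r := by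
  have hr : 0 ≤ r := (abs_nonneg _).trans h1
  have hB0 : 0 ≤ B := (abs_nonneg _).trans hB
  have e1 : |A t * x.1| ≤ B * r := by rw [abs_mul]; gcongr
  have e2 : |A t * x.2| ≤ B * r := by rw [abs_mul]; gcongr
  have e3 : |(μ + A t ^ 2) * x.1| ≤ (|μ| + B ^ 2) * r := by
    rw [abs_mul]
    have : |μ + A t ^ 2| ≤ |μ| + B ^ 2 := by
      refine (abs_add_le _ _).trans ?_
      rw [abs_pow]
      gcongr
    gcongr
  rw [Prod.norm_def]
  refine max_le ?_ ?_
  · have := abs_sub x.2 (A t * x.1)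
    have h0 : 0 ≤ (|μ| + B ^ 2) * r := by positivity
    simp only [field, Real.norm_eq_abs]
    linarith
  · have := abs_sub (A t * x.2) ((μ + A t ^ 2) * x.1)
    simp only [field, Real.norm_eq_abs]
    linarith

lemma field_sub (t : ℝ) (x y : ℝ × ℝ) :
    field A μ t x - field A μ t y = field A μ t (x - y) := by
  ext <;> simp [field] <;> ring

/-- Global existence for the linear system. -/
lemma exists_isQuasiSol (hA : ContinuousOn A (Icc 0 1)) (μ x₀ y₀ : ℝ) :
    ∃ u p : ℝ → ℝ, IsQuasiSol A μ 0 1 u p ∧ u 0 = x₀ ∧ p 0 = y₀ := by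
  obtain ⟨B, hB⟩ := isCompact_Icc.exists_bound_of_continuousOn hA
  simp only [Real.norm_eq_abs] at hB
  have hB0 : 0 ≤ B := (abs_nonneg _).trans (hB 0 (by simp))
  set K : ℝ := 1 + B + |μ| + B ^ 2 with hK
  have hK0 : 0 ≤ K := by positivity
  -- `R` is the Gronwall bound at time 1. The field truncated at `R` is bounded by `K * R`
  -- everywhere, so Picard–Lindelöf covers all of `[0,1]`; truncation does not increase absolute
  -- values, so Gronwall still gives the bound `R` and the truncation is never active.
  set R : ℝ := ‖((x₀, y₀) : ℝ × ℝ)‖ * Real.exp K with hR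
  have hR0 : 0 ≤ R := by positivity
  let f : ℝ → ℝ × ℝ → ℝ × ℝ := fun t x => field A μ t (clip R x.1, clip R x.2)
  have hPL : IsPicardLindelof f (tmin := 0) (tmax := 1) ⟨0, by simp⟩ (x₀, y₀)
      ⟨K * R, by positivity⟩ 0 ⟨K * R, by positivity⟩ ⟨K, hK0⟩ := by
    refine ⟨?_, ?_, ?_, ?_⟩
    · intro t ht
      refine LipschitzOnWith.of_dist_le_mul fun x _ y _ => ?_
      rw [dist_eq_norm, dist_eq_norm]
      simp only [f]
      rw [field_sub]
      refine norm_field_le (hB t ht) ?_ ?_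
      · exact (abs_clip_sub_le R x.1 y.1).trans (norm_fst_le (x - y))
      · exact (abs_clip_sub_le R x.2 y.2).trans (norm_snd_le (x - y))
    · intro x _
      simp only [f, field]
      fun_prop
    · intro t ht x _
      exact norm_field_le (hB t ht) (abs_clip_le hR0 _) (abs_clip_le hR0 _)
    · simp
  obtain ⟨x, hx0, hx⟩ := hPL.exists_eq_forall_mem_Icc_hasDerivWithinAt₀
  have hbound : ∀ t ∈ Icc (0 : ℝ) 1, ‖x t‖ ≤ R := by
    intro t ht
    have := norm_le_gronwallBound_of_norm_deriv_right_le (f := x) (f' := fun t => f t (x t))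
      (δ := ‖((x₀, y₀) : ℝ × ℝ)‖) (K := K) (ε := 0) (a := 0) (b := 1)
      (fun t ht => (hx t ht).continuousWithinAt)
      (fun t ht => hasDerivWithinAt_Ici_of_Icc ht (hx t (Ico_subset_Icc_self ht)))
      (by simpa using (congrArg norm hx0).le)
      (fun t ht => by
        rw [add_zero]
        exact norm_field_le (hB t (Ico_subset_Icc_self ht))
          ((abs_clip_le_abs hR0 _).trans (norm_fst_le (x t)))
          ((abs_clip_le_abs hR0 _).trans (norm_snd_le (x t)))) t ht
    refine this.trans ?_
    rw [gronwallBound_ε0, hR, sub_zero]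
    gcongr
    exact mul_le_of_le_one_right hK0 ht.2
  have hfx : ∀ t ∈ Icc (0 : ℝ) 1, f t (x t) = field A μ t (x t) := by
    intro t ht
    simp only [f]
    rw [clip_of_abs_le ((norm_fst_le (x t)).trans (hbound t ht)),
      clip_of_abs_le ((norm_snd_le (x t)).trans (hbound t ht))]
  have hx' : ∀ t ∈ Icc (0 : ℝ) 1, HasDerivWithinAt x (field A μ t (x t)) (Icc 0 1) t :=
    fun t ht => hfx t ht ▸ hx t ht
  refine ⟨fun t => (x t).1, fun t => (x t).2, ⟨fun t ht => ?_, fun t ht => ?_⟩, ?_, ?_⟩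
  · exact (hx' t ht).fst
  · exact (hx' t ht).snd
  · exact congrArg Prod.fst hx0
  · exact congrArg Prod.snd hx0

/-- `(u₁, p₁)` and `(u₂, p₂)` are the solutions on `[0,1]` with initial values `(1,0)`, `(0,1)`. -/
structure IsFundamental (A : ℝ → ℝ) (μ : ℝ) (u₁ p₁ u₂ p₂ : ℝ → ℝ) : Prop where
  sol₁ : IsQuasiSol A μ 0 1 u₁ p₁
  sol₂ : IsQuasiSol A μ 0 1 u₂ p₂
  u₁_zero : u₁ 0 = 1
  p₁_zero : p₁ 0 = 0
  u₂_zero : u₂ 0 = 0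
  p₂_zero : p₂ 0 = 1

lemma exists_isFundamental (hA : ContinuousOn A (Icc 0 1)) (μ : ℝ) :
    ∃ u₁ p₁ u₂ p₂ : ℝ → ℝ, IsFundamental A μ u₁ p₁ u₂ p₂ := by
  obtain ⟨u₁, p₁, h₁, h₁u, h₁p⟩ := exists_isQuasiSol hA μ 1 0
  obtain ⟨u₂, p₂, h₂, h₂u, h₂p⟩ := exists_isQuasiSol hA μ 0 1
  exact ⟨u₁, p₁, u₂, p₂, h₁, h₂, h₁u, h₁p, h₂u, h₂p⟩

namespace IsFundamental

variable {u₁ p₁ u₂ p₂ : ℝ → ℝ}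

lemma wronskian (h : IsFundamental A μ u₁ p₁ u₂ p₂) :
    ∀ t ∈ Icc (0 : ℝ) 1, u₁ t * p₂ t - u₂ t * p₁ t = 1 := by
  intro t ht
  rw [h.sol₁.wronskian_eq h.sol₂ t ht, h.u₁_zero, h.p₁_zero, h.u₂_zero, h.p₂_zero]
  norm_num

end IsFundamental

/-- Continuous dependence of solutions on the parameter. -/
lemma exists_dist_le_of_isQuasiSol (hA : ContinuousOn A (Icc 0 1)) (hu : IsQuasiSol A μ 0 1 u p) :
    ∃ C : ℝ, 0 ≤ C ∧ ∀ (ν : ℝ) (v q : ℝ → ℝ), IsQuasiSol A ν 0 1 v q → |ν - μ| ≤ 1 → v 0 = u 0 →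
      q 0 = p 0 → ∀ t ∈ Icc (0 : ℝ) 1, |v t - u t| ≤ C * |ν - μ| ∧ |q t - p t| ≤ C * |ν - μ| := by
  obtain ⟨B, hB⟩ := isCompact_Icc.exists_bound_of_continuousOn hA
  obtain ⟨D, hD⟩ := isCompact_Icc.exists_bound_of_continuousOn hu.continuousOn_fst
  simp only [Real.norm_eq_abs] at hB hD
  have hB0 : 0 ≤ B := (abs_nonneg _).trans (hB 0 (by simp))
  have hD0 : 0 ≤ D := (abs_nonneg _).trans (hD 0 (by simp))
  set K : ℝ := 1 + B + (|μ| + 1) + B ^ 2 with hK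
  have hK0 : 0 < K := by positivity
  refine ⟨D / K * (Real.exp K - 1), ?_, ?_⟩
  · have := Real.one_le_exp hK0.le
    have : 0 ≤ Real.exp K - 1 := by linarith
    positivity
  intro ν v q hv hν h0 h0' t ht
  have hν' : |ν| ≤ |μ| + 1 := by
    have := abs_sub_abs_le_abs_sub ν μ
    linarith
  -- The difference solves the `ν`-system with forcing `(0, (μ - ν) u)` and zero initial data. The
  -- `|μ| + 1` in `K` makes the bound uniform in `ν`.
  have key := norm_le_gronwallBound_of_norm_deriv_right_le
    (f := fun t => ((v t - u t, q t - p t) : ℝ × ℝ))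
    (f' := fun t => field A ν t (v t - u t, q t - p t) + (0, (μ - ν) * u t))
    (δ := 0) (K := K) (ε := D * |ν - μ|) (a := 0) (b := 1)
    ((hv.continuousOn_fst.sub hu.continuousOn_fst).prodMk
      (hv.continuousOn_snd.sub hu.continuousOn_snd))
    (fun t ht => by
      have ht' := Ico_subset_Icc_self ht
      refine hasDerivWithinAt_Ici_of_Icc ht ?_
      convert! ((hv.deriv_fst t ht').sub (hu.deriv_fst t ht')).prodMk
        ((hv.deriv_snd t ht').sub (hu.deriv_snd t ht')) using 1
      ext <;> simp [field] <;> ring)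
    (by simp [h0, h0'])
    (fun t ht => by
      have ht' := Ico_subset_Icc_self ht
      refine (norm_add_le _ _).trans (add_le_add ?_ ?_)
      · refine (norm_field_le (hB t ht') (norm_fst_le (_ : ℝ × ℝ)) (norm_snd_le (_ : ℝ × ℝ))).trans ?_
        rw [hK]
        gcongr
      · rw [Prod.norm_def]
        simp only [norm_zero, norm_mul, Real.norm_eq_abs]
        refine max_le (by positivity) ?_
        rw [abs_sub_comm μ ν, mul_comm]
        gcongr
        exact hD t ht') t ht
  have hle : gronwallBound 0 K (D * |ν - μ|) (t - 0) ≤ D / K * (Real.exp K - 1) * |ν - μ| := by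
    rw [gronwallBound_of_K_ne_0 hK0.ne', sub_zero]
    simp only [zero_mul, zero_add]
    have : Real.exp (K * t) ≤ Real.exp K := Real.exp_le_exp.2 (mul_le_of_le_one_right hK0.le ht.2)
    calc D * |ν - μ| / K * (Real.exp (K * t) - 1) ≤ D * |ν - μ| / K * (Real.exp K - 1) := by
          gcongr
      _ = _ := by ring
  exact ⟨(norm_fst_le (_ : ℝ × ℝ)).trans (key.trans hle),
    (norm_snd_le (_ : ℝ × ℝ)).trans (key.trans hle)⟩

end HillGreen

/-! ### Equivalence of Hill's equation with the first order system. -/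

namespace HillGreen

variable {a A : ℝ → ℝ} {m μ lam c d : ℝ} {u p : ℝ → ℝ}

/-- `A` is the primitive on `[0,1]`, vanishing at both end points, of `a - m`. -/
structure IsPrimitive (a A : ℝ → ℝ) (m : ℝ) : Prop where
  absolutelyContinuous : AbsolutelyContinuousOnInterval A 0 1
  ae_hasDerivAt : ∀ᵐ t : ℝ, t ∈ Icc (0 : ℝ) 1 → HasDerivAt A (a t - m) t
  map_zero : A 0 = 0
  map_one : A 1 = 0

lemma exists_isPrimitive (ha : IntegrableOn a (Icc (0 : ℝ) 1) volume) :
    ∃ A : ℝ → ℝ, ∃ m : ℝ, IsPrimitive a A m := by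
  have hint : IntervalIntegrable a volume 0 1 :=
    (intervalIntegrable_iff_integrableOn_Icc_of_le zero_le_one).2 ha
  have hint' : IntervalIntegrable (fun t => a t - ∫ x in (0 : ℝ)..1, a x) volume 0 1 :=
    hint.sub intervalIntegrable_const
  refine ⟨fun t => ∫ s in (0 : ℝ)..t, (a s - ∫ x in (0 : ℝ)..1, a x), ∫ x in (0 : ℝ)..1, a x,
    ?_, ?_, ?_, ?_⟩
  · exact hint'.absolutelyContinuousOnInterval_intervalIntegral (by simp)
  · filter_upwards [hint'.ae_hasDerivAt_integral] with t ht ht'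
    exact ht (by rwa [uIcc_of_le zero_le_one]) 0 (by simp)
  · exact intervalIntegral.integral_same
  · rw [intervalIntegral.integral_sub hint intervalIntegrable_const]
    simp

lemma IsPrimitive.continuousOn (h : IsPrimitive a A m) : ContinuousOn A (Icc 0 1) := by
  simpa using h.absolutelyContinuous.continuousOn

lemma ae_mem_Ioo (c d : ℝ) : ∀ᵐ t : ℝ, t ∈ Icc c d → t ∈ Ioo c d := by
  have h₁ : ∀ᵐ t : ℝ, t ≠ c := by simp [ae_iff, measure_singleton]
  have h₂ : ∀ᵐ t : ℝ, t ≠ d := by simp [ae_iff, measure_singleton]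
  filter_upwards [h₁, h₂] with t h1 h2 ht
  exact ⟨lt_of_le_of_ne ht.1 h1.symm, lt_of_le_of_ne ht.2 h2⟩

lemma absolutelyContinuousOnInterval_congr {f g : ℝ → ℝ}
    (hf : AbsolutelyContinuousOnInterval f c d) (h : EqOn f g (uIcc c d)) :
    AbsolutelyContinuousOnInterval g c d := by
  have h0 : AbsolutelyContinuousOnInterval (g - f) c d := by
    refine LipschitzOnWith.absolutelyContinuousOnInterval (K := 0) ?_
    refine LipschitzOnWith.of_dist_le_mul fun x hx y hy => ?_
    simp [h hx, h hy]
  simpa using h0.add hf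

/-- An absolutely continuous function with a.e. continuous derivative `F` is a primitive of `F`. -/
lemma hasDerivWithinAt_of_ae_hasDerivAt {f F : ℝ → ℝ} (hcd : c ≤ d)
    (hf : AbsolutelyContinuousOnInterval f c d) (hF : ContinuousOn F (Icc c d))
    (h : ∀ᵐ t : ℝ, t ∈ Icc c d → HasDerivAt f (F t) t) :
    ∀ t ∈ Icc c d, HasDerivWithinAt f (F t) (Icc c d) t := by
  have hint : IntervalIntegrable F volume c d :=
    ContinuousOn.intervalIntegrable (by rwa [uIcc_of_le hcd])
  have hac := hint.absolutelyContinuousOnInterval_intervalIntegral (c := c) (by simp)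
  obtain ⟨C, hC⟩ := (hf.fun_sub hac).const_of_ae_hasDerivAt_zero (by
    filter_upwards [h, hint.ae_hasDerivAt_integral] with t h1 h2 ht
    have := (h1 (by rwa [uIcc_of_le hcd] at ht)).sub (h2 ht c (by simp))
    rwa [sub_self] at this)
  rw [uIcc_of_le hcd] at hC
  intro t ht
  have : Fact (t ∈ Icc c d) := ⟨ht⟩
  have hd : HasDerivWithinAt (fun x => C + ∫ s in c..x, F s) (F t) (Icc c d) t := by
    refine HasDerivWithinAt.const_add _ ?_
    refine intervalIntegral.integral_hasDerivWithinAt_right ?_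
      (hF.stronglyMeasurableAtFilter_nhdsWithin measurableSet_Icc t) (hF t ht)
    exact (hF.mono (uIcc_subset_Icc (left_mem_Icc.2 hcd) ht)).intervalIntegrable
  refine hd.congr_of_mem (fun x hx => ?_) ht
  have := hC x hx
  linarith

/-- Solutions of Hill's equation solve the first order system. -/
lemma SolvesHill.isQuasiSol (hA : IsPrimitive a A m) (hcd : c < d) (hs : Icc c d ⊆ Icc 0 1)
    (h : SolvesHill a lam c d u) :
    IsQuasiSol A (lam + m) c d u (fun t => derivWithin u (Icc c d) t + A t * u t) := by
  obtain ⟨⟨hdiff, hac⟩, hae⟩ := h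
  have hu' : ∀ t ∈ Icc c d, HasDerivWithinAt u (derivWithin u (Icc c d) t) (Icc c d) t :=
    fun t ht => (hdiff t ht).hasDerivWithinAt
  have hAc : ContinuousOn A (Icc c d) := hA.continuousOn.mono hs
  have hvc : ContinuousOn (derivWithin u (Icc c d)) (Icc c d) := by
    simpa [uIcc_of_le hcd.le] using hac.continuousOn
  have huc : ContinuousOn u (Icc c d) := hdiff.continuousOn
  have huac : AbsolutelyContinuousOnInterval u c d := by
    refine ContDiffOn.absolutelyContinuousOnInterval ?_
    rw [uIcc_of_le hcd.le, contDiffOn_one_iff_derivWithin (uniqueDiffOn_Icc hcd)]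
    exact ⟨hdiff, hvc⟩
  have hAac : AbsolutelyContinuousOnInterval A c d :=
    hA.absolutelyContinuous.mono (by simpa [uIcc_of_le hcd.le] using hs)
  refine ⟨fun t ht => ?_, ?_⟩
  · convert! hu' t ht using 1
    ring
  -- Almost everywhere `a` cancels in `u'' + (a - m) u + A u'`. What remains is continuous, so the
  -- derivative exists at every point.
  · refine hasDerivWithinAt_of_ae_hasDerivAt hcd.le (hac.fun_add (hAac.fun_mul huac))
      (F := fun t => A t * (derivWithin u (Icc c d) t + A t * u t)
        - (lam + m + A t ^ 2) * u t) ?_ ?_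
    · fun_prop
    · filter_upwards [hae, hA.ae_hasDerivAt, hac.ae_differentiableAt, ae_mem_Ioo c d]
        with t h1 h2 h3 h4 ht
      have hnh : Icc c d ∈ 𝓝 t := Icc_mem_nhds (h4 ht).1 (h4 ht).2
      have hv := (h3 (by rwa [uIcc_of_le hcd.le])).hasDerivAt
      have hop := h1 ht
      rw [hillOp, derivWithin_of_mem_nhds (f := derivWithin u (Icc c d)) hnh] at hop
      convert! hv.add ((h2 (hs ht)).mul ((hu' t ht).hasDerivAt hnh)) using 1
      linear_combination (-1 : ℝ) * hop

lemma IsQuasiSol.derivWithin_fst (h : IsQuasiSol A μ c d u p) (hcd : c < d) {t : ℝ}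
    (ht : t ∈ Icc c d) : derivWithin u (Icc c d) t = p t - A t * u t :=
  (h.deriv_fst t ht).derivWithin (uniqueDiffOn_Icc hcd t ht)

/-- Solutions of the first order system solve Hill's equation. -/
lemma IsQuasiSol.solvesHill (hA : IsPrimitive a A m) (hcd : c < d) (hs : Icc c d ⊆ Icc 0 1)
    (h : IsQuasiSol A (lam + m) c d u p) : SolvesHill a lam c d u := by
  have hAc : ContinuousOn A (Icc c d) := hA.continuousOn.mono hs
  have huI : uIcc c d = Icc c d := uIcc_of_le hcd.le
  have hAac : AbsolutelyContinuousOnInterval A c d :=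
    hA.absolutelyContinuous.mono (by simpa [huI] using hs)
  have huac : AbsolutelyContinuousOnInterval u c d :=
    ContDiffOn.absolutelyContinuousOnInterval (huI ▸ h.contDiffOn_fst hcd hAc)
  have hpac : AbsolutelyContinuousOnInterval p c d :=
    ContDiffOn.absolutelyContinuousOnInterval (huI ▸ h.contDiffOn_snd hcd hAc)
  refine ⟨⟨fun t ht => (h.deriv_fst t ht).differentiableWithinAt, ?_⟩, ?_⟩
  · refine absolutelyContinuousOnInterval_congr (hpac.fun_sub (hAac.fun_mul huac)) fun t ht => ?_
    exact (h.derivWithin_fst hcd (huI ▸ ht)).symm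
  · filter_upwards [hA.ae_hasDerivAt, ae_mem_Ioo c d] with t h2 h4 ht
    have hnh : Icc c d ∈ 𝓝 t := Icc_mem_nhds (h4 ht).1 (h4 ht).2
    have hd : HasDerivAt (derivWithin u (Icc c d)) (A t * p t - (lam + m + A t ^ 2) * u t
        - ((a t - m) * u t + A t * (p t - A t * u t))) t := by
      refine HasDerivAt.congr_of_eventuallyEq (f := fun t => p t - A t * u t) ?_ ?_
      · exact (h.hasDerivAt_snd (h4 ht)).sub ((h2 (hs ht)).mul (h.hasDerivAt_fst (h4 ht)))
      · filter_upwards [hnh] with x hx using h.derivWithin_fst hcd hx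
    rw [hillOp, derivWithin_of_mem_nhds (f := derivWithin u (Icc c d)) hnh, hd.deriv]
    ring

end HillGreen

/-! ### Positivity of solutions and the first Neumann eigenvalue. -/

namespace HillGreen

variable {A : ℝ → ℝ} {μ ν : ℝ} {u p v q : ℝ → ℝ}

lemma monotoneOn_Icc_of_hasDerivWithinAt_nonneg {c d e : ℝ} {f f' : ℝ → ℝ} (hde : d ≤ e)
    (h : ∀ x ∈ Icc c e, HasDerivWithinAt f (f' x) (Icc c e) x)
    (h0 : ∀ x ∈ Ioo c d, 0 ≤ f' x) : MonotoneOn f (Icc c d) := by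
  have hs : Icc c d ⊆ Icc c e := Icc_subset_Icc_right hde
  refine monotoneOn_of_hasDerivWithinAt_nonneg (f' := f') (convex_Icc c d)
    (fun t ht => ((h t (hs ht)).mono hs).continuousWithinAt) (fun t ht => ?_) (fun t ht => ?_)
  · exact (h t (hs (interior_subset ht))).mono (interior_subset.trans hs)
  · exact h0 t (by rwa [interior_Icc] at ht)

lemma strictMonoOn_Icc_of_hasDerivWithinAt_pos {c d : ℝ} {f f' : ℝ → ℝ}
    (h : ∀ x ∈ Icc c d, HasDerivWithinAt f (f' x) (Icc c d) x)
    (h0 : ∀ x ∈ Ioo c d, 0 < f' x) : StrictMonoOn f (Icc c d) := by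
  refine strictMonoOn_of_hasDerivWithinAt_pos (f' := f') (convex_Icc c d)
    (fun t ht => (h t ht).continuousWithinAt) (fun t ht => ?_) (fun t ht => ?_)
  · exact (h t (interior_subset ht)).mono interior_subset
  · exact h0 t (by rwa [interior_Icc] at ht)

/-- Solutions of a cooperative system `r' = b V`, `V' = e r` stay positive. -/
lemma pos_of_cooperative {r V b e : ℝ → ℝ}
    (hr : ∀ t ∈ Icc (0 : ℝ) 1, HasDerivWithinAt r (b t * V t) (Icc 0 1) t)
    (hV : ∀ t ∈ Icc (0 : ℝ) 1, HasDerivWithinAt V (e t * r t) (Icc 0 1) t)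
    (hb : ∀ t ∈ Icc (0 : ℝ) 1, 0 ≤ b t) (he : ∀ t ∈ Icc (0 : ℝ) 1, 0 < e t)
    (hr0 : 0 < r 0) (hV0 : V 0 = 0) : (∀ t ∈ Icc (0 : ℝ) 1, 0 < r t) ∧ 0 < V 1 := by
  have hrc : ContinuousOn r (Icc 0 1) := fun t ht => (hr t ht).continuousWithinAt
  have hpos : ∀ t ∈ Icc (0 : ℝ) 1, 0 < r t := by
    -- Up to the first point `s` with `r s ≤ 0`, `V` increases from 0, hence `r` is nondecreasing
    -- and `r s ≥ r 0 > 0`.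
    by_contra! hne
    have hcl : IsClosed (Icc (0 : ℝ) 1 ∩ r ⁻¹' Iic 0) :=
      hrc.preimage_isClosed_of_isClosed isClosed_Icc isClosed_Iic
    have hcomp : IsCompact (Icc (0 : ℝ) 1 ∩ r ⁻¹' Iic 0) :=
      isCompact_Icc.of_isClosed_subset hcl inter_subset_left
    obtain ⟨s, ⟨hs, hs0⟩, hmin⟩ := hcomp.exists_isLeast hne
    have hpos' : ∀ t ∈ Ioo 0 s, 0 < r t := by
      intro t ht
      by_contra! hle
      exact absurd (hmin ⟨⟨ht.1.le, ht.2.le.trans hs.2⟩, hle⟩) (not_le.2 ht.2)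
    have hsub : Ioo 0 s ⊆ Icc (0 : ℝ) 1 := fun t ht => ⟨ht.1.le, ht.2.le.trans hs.2⟩
    have hVm := monotoneOn_Icc_of_hasDerivWithinAt_nonneg hs.2 hV
      (fun t ht => (mul_pos (he t (hsub ht)) (hpos' t ht)).le)
    have hrm := monotoneOn_Icc_of_hasDerivWithinAt_nonneg hs.2 hr (fun t ht => by
      have := hVm (left_mem_Icc.2 hs.1) (Ioo_subset_Icc_self ht) ht.1.le
      exact mul_nonneg (hb t (hsub ht)) (hV0 ▸ this))
    have := hrm (left_mem_Icc.2 hs.1) (right_mem_Icc.2 hs.1) hs.1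
    exact absurd (hr0.trans_le this) (not_lt.2 hs0)
  refine ⟨hpos, ?_⟩
  have hVm := strictMonoOn_Icc_of_hasDerivWithinAt_pos hV fun t ht =>
    mul_pos (he t (Ioo_subset_Icc_self ht)) (hpos t (Ioo_subset_Icc_self ht))
  have := hVm (left_mem_Icc.2 zero_le_one) (right_mem_Icc.2 zero_le_one) zero_lt_one
  rwa [hV0] at this

/-- The parameters for which the solution with initial values `(1,0)` is positive on `[0,1]`, with
`p 1 > 0`. -/
def posSet (A : ℝ → ℝ) : Set ℝ :=
  {μ | ∃ u p, IsQuasiSol A μ 0 1 u p ∧ u 0 = 1 ∧ p 0 = 0 ∧ (∀ t ∈ Icc (0 : ℝ) 1, 0 < u t) ∧ 0 < p 1}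

/-- Riccati argument: `-(p/u)` has derivative `μ + (p/u - A)²`, so for `μ ≥ 0` it cannot decrease
from 0 to the negative value `-(p 1 / u 1)`. -/
lemma neg_of_mem_posSet (h : μ ∈ posSet A) : μ < 0 := by
  obtain ⟨u, p, hs, -, hp0, hpos, hp1⟩ := h
  by_contra! hμ
  have hd : ∀ t ∈ Icc (0 : ℝ) 1, HasDerivWithinAt (fun t => -(p t / u t))
      ((μ * u t ^ 2 + (p t - A t * u t) ^ 2) / u t ^ 2) (Icc 0 1) t := by
    intro t ht
    convert! ((hs.deriv_snd t ht).div (hs.deriv_fst t ht) (hpos t ht).ne').neg using 1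
    ring
  have := monotoneOn_Icc_of_hasDerivWithinAt_nonneg le_rfl hd (fun t _ => by positivity)
    (left_mem_Icc.2 zero_le_one) (right_mem_Icc.2 zero_le_one) zero_le_one
  have h1 : 0 < p 1 / u 1 := div_pos hp1 (hpos 1 (by simp))
  simp only [hp0, zero_div] at this
  linarith

/-- Sturm comparison: the ratio `v/u` and the Wronskian `q u - v p` form a cooperative system,
because the latter has derivative `(ν - μ) u v`. -/
lemma pos_of_lt_of_mem_posSet (h : ν ∈ posSet A) (hlt : μ < ν) (hv : IsQuasiSol A μ 0 1 v q)
    (hv0 : v 0 = 1) (hq0 : q 0 = 0) : (∀ t ∈ Icc (0 : ℝ) 1, 0 < v t) ∧ 0 < q 1 := by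
  obtain ⟨u, p, hs, hu0, hp0, hpos, hp1⟩ := h
  obtain ⟨h1, h2⟩ := pos_of_cooperative (r := fun t => v t / u t)
    (V := fun t => q t * u t - v t * p t) (b := fun t => 1 / u t ^ 2)
    (e := fun t => (ν - μ) * u t ^ 2)
    (fun t ht => by
      have := (hpos t ht).ne'
      convert! (hv.deriv_fst t ht).div (hs.deriv_fst t ht) this using 1
      ring)
    (fun t ht => by
      have := (hpos t ht).ne'
      convert! ((hv.deriv_snd t ht).mul (hs.deriv_fst t ht)).sub
        ((hv.deriv_fst t ht).mul (hs.deriv_snd t ht)) using 1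
      field_simp
      ring)
    (fun t _ => by positivity)
    (fun t ht => mul_pos (sub_pos.2 hlt) (pow_pos (hpos t ht) 2))
    (by simp [hv0, hu0]) (by simp [hq0, hp0])
  have hvpos : ∀ t ∈ Icc (0 : ℝ) 1, 0 < v t := fun t ht => by
    have := mul_pos (h1 t ht) (hpos t ht)
    rwa [div_mul_cancel₀ _ (hpos t ht).ne'] at this
  refine ⟨hvpos, ?_⟩
  have h3 : 0 < v 1 * p 1 := mul_pos (hvpos 1 (by simp)) hp1
  exact pos_of_mul_pos_left (by linarith : 0 < q 1 * u 1) (hpos 1 (by simp)).le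

lemma mem_posSet_of_lt (hA : ContinuousOn A (Icc 0 1)) (h : ν ∈ posSet A) (hlt : μ < ν) :
    μ ∈ posSet A := by
  obtain ⟨v, q, hv, hv0, hq0⟩ := exists_isQuasiSol hA μ 1 0
  exact ⟨v, q, hv, hv0, hq0, pos_of_lt_of_mem_posSet h hlt hv hv0 hq0⟩

/-- Integrating factors `exp (±E)` with `E' = A` remove the diagonal terms. The system left over is
cooperative once `-μ` exceeds `A²`. -/
lemma nonempty_posSet (hA : ContinuousOn A (Icc 0 1)) : (posSet A).Nonempty := by
  obtain ⟨B, hB⟩ := isCompact_Icc.exists_bound_of_continuousOn hA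
  simp only [Real.norm_eq_abs] at hB
  obtain ⟨u, p, hs, hu0, hp0⟩ := exists_isQuasiSol hA (-(B ^ 2 + 1)) 1 0
  let E : ℝ → ℝ := fun t => ∫ s in (0 : ℝ)..t, A s
  have hE : ∀ t ∈ Icc (0 : ℝ) 1, HasDerivWithinAt E (A t) (Icc 0 1) t := by
    intro t ht
    have : Fact (t ∈ Icc (0 : ℝ) 1) := ⟨ht⟩
    refine intervalIntegral.integral_hasDerivWithinAt_right ?_
      (hA.stronglyMeasurableAtFilter_nhdsWithin measurableSet_Icc t) (hA t ht)
    exact (hA.mono (uIcc_subset_Icc (by simp) ht)).intervalIntegrable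
  obtain ⟨h1, h2⟩ := pos_of_cooperative (r := fun t => u t * Real.exp (E t))
    (V := fun t => p t * Real.exp (-E t)) (b := fun t => Real.exp (E t) ^ 2)
    (e := fun t => (B ^ 2 + 1 - A t ^ 2) * Real.exp (-E t) ^ 2)
    (fun t ht => by
      convert! (hs.deriv_fst t ht).mul (hE t ht).exp using 1
      rw [Real.exp_neg]
      field_simp
      ring)
    (fun t ht => by
      convert! (hs.deriv_snd t ht).mul (hE t ht).fun_neg.exp using 1
      rw [Real.exp_neg]
      field_simp
      ring)
    (fun t _ => by positivity)
    (fun t ht => by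
      have := sq_le_sq' (abs_le.1 (hB t ht)).1 (abs_le.1 (hB t ht)).2
      have : 0 < B ^ 2 + 1 - A t ^ 2 := by linarith
      positivity)
    (by simp [hu0, Real.exp_pos]) (by simp [hp0])
  exact ⟨_, u, p, hs, hu0, hp0, fun t ht => pos_of_mul_pos_left (h1 t ht) (Real.exp_pos _).le,
    pos_of_mul_pos_left h2 (Real.exp_pos _).le⟩

/-- A nonnegative solution with `u 0 > 0` and `p 1 ≥ 0` is positive. -/
lemma IsQuasiSol.pos_of_nonneg (hA : ContinuousOn A (Icc 0 1)) (hs : IsQuasiSol A μ 0 1 u p)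
    (hu0 : u 0 = 1) (hp0 : p 0 = 0) (hnn : ∀ t ∈ Icc (0 : ℝ) 1, 0 ≤ u t) (hp1 : 0 ≤ p 1) :
    ∀ t ∈ Icc (0 : ℝ) 1, 0 < u t := by
  intro t ht
  refine lt_of_le_of_ne (hnn t ht) fun h0 => ?_
  -- The Wronskian with a second solution forbids `u t = p t = 0`. An interior zero is a minimum,
  -- which forces `p t = 0`; at 1 the one-sided slope gives `p 1 ≤ 0`, against `hp1` and `p 1 ≠ 0`.
  obtain ⟨v, q, hv, hv0, hq0⟩ := exists_isQuasiSol hA μ 0 1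
  have hw := hs.wronskian_eq hv t ht
  simp only [← h0, hu0, hp0, hv0, hq0] at hw
  have hpt : p t ≠ 0 := fun h => by simp [h] at hw
  have ht0 : t ≠ 0 := fun h => by simp [h, hu0] at h0
  rcases ht.2.eq_or_lt with rfl | ht1
  · have hd := hasDerivWithinAt_iff_tendsto_slope.1 (hs.deriv_fst 1 ht)
    have hne : (𝓝[Icc (0 : ℝ) 1 \ {1}] 1).NeBot := by
      rw [Icc_sdiff_right, nhdsWithin_Ico_eq_nhdsLT zero_lt_one]
      infer_instance
    have hle : p 1 - A 1 * u 1 ≤ 0 := by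
      refine le_of_tendsto hd ?_
      filter_upwards [self_mem_nhdsWithin] with x hx
      rw [slope_def_field, ← h0]
      refine div_nonpos_of_nonneg_of_nonpos ?_ ?_
      · simpa using hnn x hx.1
      · linarith [hx.1.2]
    rw [← h0] at hle
    exact hpt (le_antisymm (by linarith) hp1)
  · have hmem : t ∈ Ioo (0 : ℝ) 1 := ⟨lt_of_le_of_ne ht.1 ht0.symm, ht1⟩
    have hmin : IsLocalMin u t := by
      filter_upwards [Icc_mem_nhds hmem.1 hmem.2] with x hx
      rw [← h0]
      exact hnn x hx
    have := hmin.hasDerivAt_eq_zero (hs.hasDerivAt_fst hmem)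
    rw [← h0] at this
    exact hpt (by linarith)

/-- The supremum of `posSet A` is a Neumann eigenvalue of the first order system. -/
lemma exists_first_eigenvalue (hA : ContinuousOn A (Icc 0 1)) :
    ∃ μ₀ : ℝ, (∀ μ < μ₀, μ ∈ posSet A) ∧
      ∃ u p, IsQuasiSol A μ₀ 0 1 u p ∧ u 0 = 1 ∧ p 0 = 0 ∧ p 1 = 0 := by
  have hne := nonempty_posSet hA
  have hbdd : BddAbove (posSet A) := ⟨0, fun μ hμ => (neg_of_mem_posSet hμ).le⟩
  set μ₀ := sSup (posSet A) with hμ₀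
  have hlt : ∀ μ < μ₀, μ ∈ posSet A := fun μ hμ => by
    obtain ⟨ν, hν, h⟩ := exists_lt_of_lt_csSup hne hμ
    exact mem_posSet_of_lt hA hν h
  obtain ⟨u, p, hs, hu0, hp0⟩ := exists_isQuasiSol hA μ₀ 1 0
  refine ⟨μ₀, hlt, u, p, hs, hu0, hp0, ?_⟩
  obtain ⟨C, hC, hdist⟩ := exists_dist_le_of_isQuasiSol hA hs
  have hlow : ∀ δ : ℝ, 0 < δ → δ ≤ 1 → (∀ t ∈ Icc (0 : ℝ) 1, -(C * δ) ≤ u t) ∧ -(C * δ) ≤ p 1 := by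
    intro δ hδ hδ1
    obtain ⟨v, q, hv, hv0, hq0, hvpos, hq1⟩ := hlt (μ₀ - δ) (by linarith)
    have habs : |μ₀ - δ - μ₀| = δ := by simp [abs_of_pos hδ]
    have hd := hdist _ v q hv (by rw [habs]; exact hδ1) (by rw [hv0, hu0]) (by rw [hq0, hp0])
    rw [habs] at hd
    refine ⟨fun t ht => ?_, ?_⟩
    · have := (abs_le.1 (hd t ht).1).2
      linarith [hvpos t ht]
    · have := (abs_le.1 (hd 1 (by simp)).2).2
      linarith
  have hlim : ∀ x : ℝ, (∀ δ : ℝ, 0 < δ → δ ≤ 1 → -(C * δ) ≤ x) → 0 ≤ x := by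
    intro x hx
    have ht : Tendsto (fun δ : ℝ => -(C * δ)) (𝓝[>] 0) (𝓝 0) := by
      have : Continuous fun δ : ℝ => -(C * δ) := by fun_prop
      simpa using (this.tendsto 0).mono_left nhdsWithin_le_nhds
    refine le_of_tendsto ht ?_
    filter_upwards [Ioc_mem_nhdsGT (zero_lt_one' ℝ)] with δ hδ using hx δ hδ.1 hδ.2
  have hp1 : 0 ≤ p 1 := hlim _ fun δ h h' => (hlow δ h h').2
  have hpos := hs.pos_of_nonneg hA hu0 hp0
    (fun t ht => hlim _ fun δ h h' => (hlow δ h h').1 t ht) hp1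
  refine le_antisymm ?_ hp1
  by_contra! hp1'
  obtain ⟨s, hs', hmin⟩ := isCompact_Icc.exists_isMinOn (nonempty_Icc.2 (zero_le_one' ℝ))
    hs.continuousOn_fst
  have hus := hpos s hs'
  -- Small enough that an error `C * ε` destroys neither `u ≥ u s > 0` nor `p 1 > 0`.
  set ε := min (min (u s) (p 1) / (2 * (C + 1))) 1 with hε
  have hε0 : 0 < ε := by positivity
  have hεC : C * ε < min (u s) (p 1) := by
    have h1 : ε ≤ min (u s) (p 1) / (2 * (C + 1)) := min_le_left _ _
    rw [le_div_iff₀ (by positivity)] at h1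
    nlinarith
  obtain ⟨v, q, hv, hv0, hq0⟩ := exists_isQuasiSol hA (μ₀ + ε) 1 0
  have habs : |μ₀ + ε - μ₀| = ε := by simp [abs_of_pos hε0]
  have hd := hdist _ v q hv (by rw [habs]; exact min_le_right _ _) (by rw [hv0, hu0])
    (by rw [hq0, hp0])
  rw [habs] at hd
  have hmem : μ₀ + ε ∈ posSet A := by
    refine ⟨v, q, hv, hv0, hq0, fun t ht => ?_, ?_⟩
    · have h1 := (abs_le.1 (hd t ht).1).1
      have h2 : u s ≤ u t := hmin ht
      have h3 := min_le_left (u s) (p 1)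
      linarith
    · have h1 := (abs_le.1 (hd 1 (by simp)).2).1
      have h3 := min_le_right (u s) (p 1)
      linarith
  have := le_csSup hbdd hmem
  linarith

namespace IsFundamental

variable {u₁ p₁ u₂ p₂ : ℝ → ℝ}

/-- The derivative of `u₂ / u₁` is the Wronskian 1 divided by `u₁²`. -/
lemma strictMonoOn_ratio (h : IsFundamental A μ u₁ p₁ u₂ p₂)
    (hpos : ∀ t ∈ Icc (0 : ℝ) 1, 0 < u₁ t) : StrictMonoOn (fun t => u₂ t / u₁ t) (Icc 0 1) := by
  refine strictMonoOn_Icc_of_hasDerivWithinAt_pos (f' := fun t => 1 / u₁ t ^ 2) (fun t ht => ?_)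
    (fun t ht => by have := hpos t (Ioo_subset_Icc_self ht); positivity)
  convert! (h.sol₂.deriv_fst t ht).div (h.sol₁.deriv_fst t ht) (hpos t ht).ne' using 1
  rw [← h.wronskian t ht]
  ring

lemma u₂_pos (h : IsFundamental A μ u₁ p₁ u₂ p₂) (hpos : ∀ t ∈ Icc (0 : ℝ) 1, 0 < u₁ t) {t : ℝ}
    (ht : t ∈ Ioc (0 : ℝ) 1) : 0 < u₂ t := by
  have := h.strictMonoOn_ratio hpos (left_mem_Icc.2 zero_le_one) (Ioc_subset_Icc_self ht) ht.1
  simp only [h.u₂_zero, zero_div] at this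
  exact (div_pos_iff_of_pos_right (hpos t (Ioc_subset_Icc_self ht))).1 this

/-- Times `u₁ 1`, the expression is at least `u₁ t` by monotonicity of `u₂ / u₁` and the Wronskian
at 1. It is the right factor of the Neumann and Mixed 2 kernels; `t = 0` gives `p₂ 1 > 0`. -/
lemma neumann_right_pos (h : IsFundamental A μ u₁ p₁ u₂ p₂)
    (hpos : ∀ t ∈ Icc (0 : ℝ) 1, 0 < u₁ t) (hp1 : 0 < p₁ 1) {t : ℝ} (ht : t ∈ Icc (0 : ℝ) 1) :
    0 < p₂ 1 * u₁ t - p₁ 1 * u₂ t := by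
  have hm := h.strictMonoOn_ratio hpos
  have hle : u₂ t / u₁ t ≤ u₂ 1 / u₁ 1 := hm.monotoneOn ht (right_mem_Icc.2 zero_le_one) ht.2
  have h1 := hpos 1 (by simp)
  have h2 := hpos t ht
  rw [div_le_div_iff₀ h2 h1] at hle
  have hw := h.wronskian 1 (by simp)
  refine pos_of_mul_pos_left (b := u₁ 1) ?_ h1.le
  nlinarith [mul_le_mul_of_nonneg_left hle hp1.le]

lemma dirichlet_right_neg (h : IsFundamental A μ u₁ p₁ u₂ p₂)
    (hpos : ∀ t ∈ Icc (0 : ℝ) 1, 0 < u₁ t) {t : ℝ} (ht : t ∈ Ico (0 : ℝ) 1) :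
    u₁ 1 * u₂ t - u₂ 1 * u₁ t < 0 := by
  have hlt := h.strictMonoOn_ratio hpos (Ico_subset_Icc_self ht) (right_mem_Icc.2 zero_le_one) ht.2
  simp only at hlt
  rw [div_lt_div_iff₀ (hpos t (Ico_subset_Icc_self ht)) (hpos 1 (by simp))] at hlt
  linarith

end IsFundamental

end HillGreen

/-! ### Green's functions from pairs of solutions. -/

namespace HillGreen

variable {a A : ℝ → ℝ} {m μ lam c d W : ℝ} {u p v q f f' g g' : ℝ → ℝ} {bc : BoundaryCondition}

lemma IsQuasiSol.congr (h : IsQuasiSol A μ c d u p) (hv : EqOn v u (Icc c d))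
    (hq : EqOn q p (Icc c d)) : IsQuasiSol A μ c d v q := by
  refine ⟨fun t ht => ?_, fun t ht => ?_⟩
  · rw [hv ht, hq ht]
    exact (h.deriv_fst t ht).congr_of_mem hv ht
  · rw [hv ht, hq ht]
    exact (h.deriv_snd t ht).congr_of_mem hq ht

lemma IsQuasiSol.const_mul (h : IsQuasiSol A μ c d u p) (k : ℝ) :
    IsQuasiSol A μ c d (fun t => k * u t) (fun t => k * p t) :=
  (h.lincomb h k 0).congr (fun t _ => by simp) (fun t _ => by simp)

/-- The boundary condition at `0`, in terms of the values of the function and its derivative. -/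
def BoundaryCondition.Left : BoundaryCondition → ℝ → ℝ → Prop
  | .neumann, _, y => y = 0
  | .mixed1, _, y => y = 0
  | .mixed2, x, _ => x = 0

/-- The boundary condition at `1`, in terms of the values of the function and its derivative. -/
def BoundaryCondition.Right : BoundaryCondition → ℝ → ℝ → Prop
  | .neumann, _, y => y = 0
  | .mixed1, x, _ => x = 0
  | .mixed2, _, y => y = 0

namespace BoundaryCondition

lemma holds_iff : bc.Holds u ↔ bc.Left (u 0) (derivWithin u (Icc 0 1) 0) ∧
    bc.Right (u 1) (derivWithin u (Icc 0 1) 1) := by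
  cases bc <;> rfl

lemma Left.const_mul {x y : ℝ} (h : bc.Left x y) (k : ℝ) : bc.Left (k * x) (k * y) := by
  cases bc <;> simp_all [Left]

lemma Right.const_mul {x y : ℝ} (h : bc.Right x y) (k : ℝ) : bc.Right (k * x) (k * y) := by
  cases bc <;> simp_all [Right]

/-- Each condition cuts out a line, so two vectors satisfying it have zero determinant. -/
lemma Left.mul_sub_mul {x y z w : ℝ} (h : bc.Left x y) (h' : bc.Left z w) : x * w - z * y = 0 := by
  cases bc <;> simp_all [Left]

lemma Right.mul_sub_mul {x y z w : ℝ} (h : bc.Right x y) (h' : bc.Right z w) :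
    x * w - z * y = 0 := by
  cases bc <;> simp_all [Right]

end BoundaryCondition

lemma derivWithin_Icc_left {s : ℝ} (hs : s ∈ Ioo (0 : ℝ) 1) (u : ℝ → ℝ) :
    derivWithin u (Icc 0 1) 0 = derivWithin u (Icc 0 s) 0 := by
  refine derivWithin_congr_set ?_
  filter_upwards [Iio_mem_nhds hs.1] with x hx
  exact propext ⟨fun h => ⟨h.1, (show x < s from hx).le⟩, fun h => ⟨h.1, h.2.trans hs.2.le⟩⟩

lemma derivWithin_Icc_right {s : ℝ} (hs : s ∈ Ioo (0 : ℝ) 1) (u : ℝ → ℝ) :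
    derivWithin u (Icc 0 1) 1 = derivWithin u (Icc s 1) 1 := by
  refine derivWithin_congr_set ?_
  filter_upwards [Ioi_mem_nhds hs.2] with x hx
  exact propext ⟨fun h => ⟨(show s < x from hx).le, h.2⟩, fun h => ⟨hs.1.le.trans h.1, h.2⟩⟩

/-- Solutions `(f, f')` and `(g, g')` of the first order system that satisfy the boundary conditions
at `0` and at `1`, respectively, with Wronskian `W ≠ 0`. -/
structure IsGreenPair (A : ℝ → ℝ) (bc : BoundaryCondition) (μ : ℝ) (f f' g g' : ℝ → ℝ) (W : ℝ) :
    Prop where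
  sol_left : IsQuasiSol A μ 0 1 f f'
  sol_right : IsQuasiSol A μ 0 1 g g'
  left : bc.Left (f 0) (f' 0)
  right : bc.Right (g 1) (g' 1)
  wronskian : ∀ t ∈ Icc (0 : ℝ) 1, f t * g' t - g t * f' t = W
  wronskian_ne_zero : W ≠ 0

/-- The kernel built from a left and a right solution. -/
noncomputable def green (f g : ℝ → ℝ) (W t s : ℝ) : ℝ := f (min t s) * g (max t s) / W

lemma green_of_le {t s : ℝ} (h : t ≤ s) : green f g W t s = f t * g s / W := by
  simp [green, h]

lemma green_of_ge {t s : ℝ} (h : s ≤ t) : green f g W t s = f s * g t / W := by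
  simp [green, h]

namespace IsGreenPair

variable {G : ℝ → ℝ → ℝ}

/-- The Wronskian of `u` and `f` vanishes at 0, hence throughout, so `u` has no `g`-component in the
basis `f`, `g`. -/
lemma eq_mul_left (h : IsGreenPair A bc μ f f' g g' W) {s : ℝ} (hs : s ∈ Icc (0 : ℝ) 1)
    (hu : IsQuasiSol A μ 0 s u p) (hb : bc.Left (u 0) (p 0)) :
    ∃ α : ℝ, ∀ t ∈ Icc 0 s, u t = α * f t ∧ p t = α * f' t := by
  have hsub : Icc 0 s ⊆ Icc (0 : ℝ) 1 := Icc_subset_Icc_right hs.2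
  refine ⟨(u 0 * g' 0 - g 0 * p 0) / W, fun t ht => ?_⟩
  have h1 := hu.wronskian_eq (h.sol_right.mono hsub) t ht
  have h2 := hu.wronskian_eq (h.sol_left.mono hsub) t ht
  rw [hb.mul_sub_mul h.left] at h2
  have h3 := h.wronskian t (hsub ht)
  have hW := h.wronskian_ne_zero
  rw [← h1]
  constructor
  · field_simp
    linear_combination (-u t) * h3 + (-g t) * h2
  · field_simp
    linear_combination (-p t) * h3 + (-g' t) * h2

lemma eq_mul_right (h : IsGreenPair A bc μ f f' g g' W) {s : ℝ} (hs : s ∈ Icc (0 : ℝ) 1)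
    (hu : IsQuasiSol A μ s 1 u p) (hb : bc.Right (u 1) (p 1)) :
    ∃ β : ℝ, ∀ t ∈ Icc s 1, u t = β * g t ∧ p t = β * g' t := by
  have hsub : Icc s 1 ⊆ Icc (0 : ℝ) 1 := Icc_subset_Icc_left hs.1
  refine ⟨(f s * p s - u s * f' s) / W, fun t ht => ?_⟩
  have h1 := (h.sol_left.mono hsub).wronskian_eq hu t ht
  have h2 := hu.wronskian_eq (h.sol_right.mono hsub) t ht
  -- The Wronskian with `g` is known to vanish at 1; this carries it back to the left end `s`.
  have h2' := hu.wronskian_eq (h.sol_right.mono hsub) 1 (right_mem_Icc.2 hs.2)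
  rw [hb.mul_sub_mul h.right] at h2'
  rw [← h2'] at h2
  have h3 := h.wronskian t (hsub ht)
  have hW := h.wronskian_ne_zero
  rw [← h1]
  constructor
  · field_simp
    linear_combination (-u t) * h3 + f t * h2
  · field_simp
    linear_combination (-p t) * h3 + f' t * h2

/-- A solution of the homogeneous problem is a multiple of both `f` and `g`, which are independent.
-/
lemma isNonresonant (hA : IsPrimitive a A m) (h : IsGreenPair A bc (lam + m) f f' g g' W) :
    IsNonresonant a bc lam := by
  intro u hu hb t ht
  have hq := hu.isQuasiSol hA zero_lt_one subset_rfl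
  rw [BoundaryCondition.holds_iff] at hb
  obtain ⟨α, hα⟩ := h.eq_mul_left (right_mem_Icc.2 zero_le_one) hq
    (by simpa [hA.map_zero] using hb.1)
  obtain ⟨β, hβ⟩ := h.eq_mul_right (left_mem_Icc.2 zero_le_one) hq
    (by simpa [hA.map_one] using hb.2)
  have h1 := h.wronskian t ht
  obtain ⟨e1, e2⟩ := hα t ht
  obtain ⟨e3, e4⟩ := hβ t ht
  refine (mul_eq_zero.1 (?_ : u t * W = 0)).resolve_right h.wronskian_ne_zero
  rw [← h1]
  rw [e4] at e2
  rw [e3] at e1 ⊢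
  linear_combination g t * f t * e2 - g t * f' t * e1

/-- A Green's function is the kernel built from a pair of solutions. -/
lemma eq_green (hA : IsPrimitive a A m) (h : IsGreenPair A bc (lam + m) f f' g g' W)
    (hG : IsGreenFunction a bc lam G) :
    ∀ t ∈ Icc (0 : ℝ) 1, ∀ s ∈ Icc (0 : ℝ) 1, G t s = green f g W t s := by
  have hfc := h.sol_left.continuousOn_fst
  have hgc := h.sol_right.continuousOn_fst
  have hf'c := h.sol_left.continuousOn_snd
  have hg'c := h.sol_right.continuousOn_snd
  have hAc := hA.continuousOn
  have hinner : ∀ t ∈ Icc (0 : ℝ) 1, ∀ s ∈ Ioo (0 : ℝ) 1, G t s = green f g W t s := by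
    intro t ht s hs
    have hs' := Ioo_subset_Icc_self hs
    have hnh : Icc (0 : ℝ) 1 ∈ 𝓝 s := Icc_mem_nhds hs.1 hs.2
    have hb := BoundaryCondition.holds_iff.1 (hG.boundary s hs)
    have hql := (hG.solves_left s hs).isQuasiSol hA hs.1 (Icc_subset_Icc_right hs.2.le)
    have hqr := (hG.solves_right s hs).isQuasiSol hA hs.2 (Icc_subset_Icc_left hs.1.le)
    obtain ⟨α, hα⟩ := h.eq_mul_left hs' hql
      (by simpa [hA.map_zero, ← derivWithin_Icc_left hs] using hb.1)
    obtain ⟨β, hβ⟩ := h.eq_mul_right hs' hqr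
      (by simpa [hA.map_one, ← derivWithin_Icc_right hs] using hb.2)
    -- Continuity at `s` and the unit jump form a 2×2 linear system, whose solution is `α = g s /
    -- W`, `β = f s / W`.
    have h1 : α * f s = β * g s := by
      rw [← (hα s (right_mem_Icc.2 hs.1.le)).1, ← (hβ s (left_mem_Icc.2 hs.2.le)).1]
    obtain ⟨l, r, hl, -, hr, -, hrl⟩ := hG.jump s hs
    have hl' : l = α * (f' s - A s * f s) := by
      refine tendsto_nhds_unique hl ?_
      have hc : ContinuousAt (fun τ => α * (f' τ - A τ * f τ)) s :=
        (continuousOn_const.mul (hf'c.sub (hAc.mul hfc))).continuousAt hnh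
      refine Tendsto.congr' ?_ (hc.tendsto.mono_left nhdsWithin_le_nhds)
      filter_upwards [Ioo_mem_nhdsLT hs.1] with τ hτ
      rw [(hql.hasDerivAt_fst hτ).deriv, (hα τ (Ioo_subset_Icc_self hτ)).2,
        (hα τ (Ioo_subset_Icc_self hτ)).1]
      ring
    have hr' : r = β * (g' s - A s * g s) := by
      refine tendsto_nhds_unique hr ?_
      have hc : ContinuousAt (fun τ => β * (g' τ - A τ * g τ)) s :=
        (continuousOn_const.mul (hg'c.sub (hAc.mul hgc))).continuousAt hnh
      refine Tendsto.congr' ?_ (hc.tendsto.mono_left nhdsWithin_le_nhds)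
      filter_upwards [Ioo_mem_nhdsGT hs.2] with τ hτ
      rw [(hqr.hasDerivAt_fst hτ).deriv, (hβ τ (Ioo_subset_Icc_self hτ)).2,
        (hβ τ (Ioo_subset_Icc_self hτ)).1]
      ring
    have hw := h.wronskian s hs'
    have hW := h.wronskian_ne_zero
    rw [hl', hr'] at hrl
    rcases le_total t s with hts | hts
    · rw [green_of_le hts, (hα t ⟨ht.1, hts⟩).1, eq_div_iff hW]
      have : α * W = g s := by
        rw [← hw]
        linear_combination g s * hrl + (g' s - A s * g s) * h1
      linear_combination f t * this
    · rw [green_of_ge hts, (hβ t ⟨hts, ht.2⟩).1, eq_div_iff hW]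
      have : β * W = f s := by
        rw [← hw]
        linear_combination f s * hrl + (f' s - A s * f s) * h1
      linear_combination g t * this
  intro t ht
  have hEq : EqOn (fun s => G t s) (fun s => green f g W t s) (Ioo 0 1) := fun s hs =>
    hinner t ht s hs
  -- At `s = 0` and `s = 1` no boundary or jump condition is imposed; these values follow by
  -- continuity.
  refine hEq.of_subset_closure (t := Icc 0 1) ?_ ?_ Ioo_subset_Icc_self (by simp)
  · exact hG.continuousOn.comp (f := fun s => (t, s)) (by fun_prop) fun s hs => ⟨ht, hs⟩
  · refine ContinuousOn.div_const (ContinuousOn.mul ?_ ?_) _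
    · exact hfc.comp (by fun_prop) fun s hs => ⟨le_min ht.1 hs.1, (min_le_left _ _).trans ht.2⟩
    · exact hgc.comp (by fun_prop) fun s hs => ⟨ht.1.trans (le_max_left _ _), max_le ht.2 hs.2⟩

/-- Here `f'` is the second component of the system, so the true derivative of `f` is `f' - A f`. -/
lemma hasDerivAt_green_of_lt (h : IsGreenPair A bc μ f f' g g' W) {t s : ℝ}
    (ht : t ∈ Ioo (0 : ℝ) 1) (hts : t < s) :
    HasDerivAt (fun x => green f g W x s) ((f' t - A t * f t) * g s / W) t := by
  refine (((h.sol_left.hasDerivAt_fst ht).mul_const (g s)).div_const W).congr_of_eventuallyEq ?_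
  filter_upwards [Iio_mem_nhds hts] with x hx using green_of_le (le_of_lt hx)

lemma hasDerivAt_green_of_gt (h : IsGreenPair A bc μ f f' g g' W) {t s : ℝ}
    (ht : t ∈ Ioo (0 : ℝ) 1) (hts : s < t) :
    HasDerivAt (fun x => green f g W x s) (f s * (g' t - A t * g t) / W) t := by
  refine (((h.sol_right.hasDerivAt_fst ht).const_mul (f s)).div_const W).congr_of_eventuallyEq ?_
  filter_upwards [Ioi_mem_nhds hts] with x hx using green_of_ge (le_of_lt hx)

lemma hasDerivWithinAt_green_zero (hA : IsPrimitive a A m) (h : IsGreenPair A bc μ f f' g g' W)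
    {s : ℝ} (hs : 0 < s) :
    HasDerivWithinAt (fun x => green f g W x s) (f' 0 * g s / W) (Icc 0 1) 0 := by
  have h0 := h.sol_left.deriv_fst 0 (by simp)
  rw [hA.map_zero, zero_mul, sub_zero] at h0
  refine ((h0.mul_const (g s)).div_const W).congr_of_eventuallyEq ?_ (green_of_le hs.le)
  filter_upwards [nhdsWithin_le_nhds (Iio_mem_nhds hs)] with x hx using green_of_le (le_of_lt hx)

lemma hasDerivWithinAt_green_one (hA : IsPrimitive a A m) (h : IsGreenPair A bc μ f f' g g' W)
    {s : ℝ} (hs : s < 1) :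
    HasDerivWithinAt (fun x => green f g W x s) (f s * g' 1 / W) (Icc 0 1) 1 := by
  have h0 := h.sol_right.deriv_fst 1 (by simp)
  rw [hA.map_one, zero_mul, sub_zero] at h0
  refine ((h0.const_mul (f s)).div_const W).congr_of_eventuallyEq ?_ (green_of_ge hs.le)
  filter_upwards [nhdsWithin_le_nhds (Ioi_mem_nhds hs)] with x hx using green_of_ge (le_of_lt hx)

lemma contDiffOn_green (hAc : ContinuousOn A (Icc 0 1)) (h : IsGreenPair A bc μ f f' g g' W) :
    ContDiffOn ℝ 1 (Function.uncurry (green f g W))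
      {p : ℝ × ℝ | p ∈ Icc (0 : ℝ) 1 ×ˢ Icc (0 : ℝ) 1 ∧ p.1 ≠ p.2} := by
  have hf := h.sol_left.contDiffOn_fst zero_lt_one hAc
  have hg := h.sol_right.contDiffOn_fst zero_lt_one hAc
  set S := {p : ℝ × ℝ | p ∈ Icc (0 : ℝ) 1 ×ˢ Icc (0 : ℝ) 1 ∧ p.1 ≠ p.2}
  have h1 : MapsTo Prod.fst S (Icc (0 : ℝ) 1) := fun p hp => hp.1.1
  have h2 : MapsTo Prod.snd S (Icc (0 : ℝ) 1) := fun p hp => hp.1.2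
  have hlt : ContDiffOn ℝ 1 (fun p : ℝ × ℝ => f p.1 * g p.2 / W) S :=
    ((hf.comp contDiff_fst.contDiffOn h1).mul (hg.comp contDiff_snd.contDiffOn h2)).div_const W
  have hgt : ContDiffOn ℝ 1 (fun p : ℝ × ℝ => f p.2 * g p.1 / W) S :=
    ((hf.comp contDiff_snd.contDiffOn h2).mul (hg.comp contDiff_fst.contDiffOn h1)).div_const W
  intro p hp
  rcases lt_or_gt_of_ne hp.2 with hlt' | hgt'
  · refine (hlt p hp).congr_of_eventuallyEq ?_ (green_of_le hlt'.le)
    filter_upwards [nhdsWithin_le_nhds ((isOpen_lt continuous_fst continuous_snd).mem_nhds hlt')]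
      with x hx using green_of_le (le_of_lt hx)
  · refine (hgt p hp).congr_of_eventuallyEq ?_ (green_of_ge hgt'.le)
    filter_upwards [nhdsWithin_le_nhds ((isOpen_lt continuous_snd continuous_fst).mem_nhds hgt')]
      with x hx using green_of_ge (le_of_lt hx)

lemma isGreenFunction (hA : IsPrimitive a A m) (h : IsGreenPair A bc (lam + m) f f' g g' W) :
    IsGreenFunction a bc lam (green f g W) := by
  have hfc := h.sol_left.continuousOn_fst
  have hgc := h.sol_right.continuousOn_fst
  have hf'c := h.sol_left.continuousOn_snd
  have hg'c := h.sol_right.continuousOn_snd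
  have hAc := hA.continuousOn
  refine ⟨?_, h.contDiffOn_green hAc, fun s hs => ?_, fun s hs => ?_, fun s hs => ?_,
    fun t ht => ?_⟩
  · refine ContinuousOn.div_const (ContinuousOn.mul ?_ ?_) _
    · exact hfc.comp (by fun_prop) fun p hp =>
        ⟨le_min hp.1.1 hp.2.1, (min_le_left _ _).trans hp.1.2⟩
    · exact hgc.comp (by fun_prop) fun p hp =>
        ⟨hp.1.1.trans (le_max_left _ _), max_le hp.1.2 hp.2.2⟩
  · have hsub : Icc 0 s ⊆ Icc (0 : ℝ) 1 := Icc_subset_Icc_right hs.2.le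
    refine IsQuasiSol.solvesHill (p := fun t => g s / W * f' t) hA hs.1 hsub
      (((h.sol_left.mono hsub).const_mul (g s / W)).congr (fun t ht => ?_) fun _ _ => rfl)
    simp only [green_of_le ht.2]
    ring
  · have hsub : Icc s 1 ⊆ Icc (0 : ℝ) 1 := Icc_subset_Icc_left hs.1.le
    refine IsQuasiSol.solvesHill (p := fun t => f s / W * g' t) hA hs.2 hsub
      (((h.sol_right.mono hsub).const_mul (f s / W)).congr (fun t ht => ?_) fun _ _ => rfl)
    simp only [green_of_ge ht.1]
    ring
  · have hu := uniqueDiffOn_Icc (zero_lt_one' ℝ)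
    rw [BoundaryCondition.holds_iff,
      (h.hasDerivWithinAt_green_zero hA hs.1).derivWithin (hu 0 (by simp)),
      (h.hasDerivWithinAt_green_one hA hs.2).derivWithin (hu 1 (by simp)),
      green_of_le hs.1.le, green_of_ge hs.2.le]
    refine ⟨?_, ?_⟩
    · convert! h.left.const_mul (g s / W) using 1 <;> ring
    · convert! h.right.const_mul (f s / W) using 1 <;> ring
  · have hnh : Icc (0 : ℝ) 1 ∈ 𝓝 t := Icc_mem_nhds ht.1 ht.2
    refine ⟨(f' t - A t * f t) * g t / W, f t * (g' t - A t * g t) / W, ?_, ?_, ?_, ?_, ?_⟩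
    · have hc : ContinuousAt (fun τ => (f' τ - A τ * f τ) * g t / W) t :=
        (((hf'c.sub (hAc.mul hfc)).mul continuousOn_const).div_const W).continuousAt hnh
      refine Tendsto.congr' ?_ (hc.tendsto.mono_left nhdsWithin_le_nhds)
      filter_upwards [Ioo_mem_nhdsLT ht.1] with τ hτ
      exact (h.hasDerivAt_green_of_lt ⟨hτ.1, hτ.2.trans ht.2⟩ hτ.2).deriv.symm
    · have hc : ContinuousAt (fun s => (f' t - A t * f t) * g s / W) t :=
        ((continuousOn_const.mul hgc).div_const W).continuousAt hnh
      refine Tendsto.congr' ?_ (hc.tendsto.mono_left nhdsWithin_le_nhds)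
      filter_upwards [self_mem_nhdsWithin] with s hs
      exact (h.hasDerivAt_green_of_lt ht hs).deriv.symm
    · have hc : ContinuousAt (fun τ => f t * (g' τ - A τ * g τ) / W) t :=
        ((continuousOn_const.mul (hg'c.sub (hAc.mul hgc))).div_const W).continuousAt hnh
      refine Tendsto.congr' ?_ (hc.tendsto.mono_left nhdsWithin_le_nhds)
      filter_upwards [Ioo_mem_nhdsGT ht.2] with τ hτ
      exact (h.hasDerivAt_green_of_gt ⟨ht.1.trans hτ.1, hτ.2⟩ hτ.1).deriv.symm
    · have hc : ContinuousAt (fun s => f s * (g' t - A t * g t) / W) t :=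
        ((hfc.mul continuousOn_const).div_const W).continuousAt hnh
      refine Tendsto.congr' ?_ (hc.tendsto.mono_left nhdsWithin_le_nhds)
      filter_upwards [self_mem_nhdsWithin] with s hs
      exact (h.hasDerivAt_green_of_gt ht hs).deriv.symm
    · have hw := h.wronskian t (Ioo_subset_Icc_self ht)
      have hW := h.wronskian_ne_zero
      field_simp
      linear_combination hw

end IsGreenPair

/-- A nontrivial solution of the first order system satisfying the boundary conditions yields an
eigenvalue. -/
lemma IsQuasiSol.isEigenvalue (hA : IsPrimitive a A m) (h : IsQuasiSol A (lam + m) 0 1 u p)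
    (hl : bc.Left (u 0) (p 0)) (hr : bc.Right (u 1) (p 1)) {t : ℝ} (ht : t ∈ Icc (0 : ℝ) 1)
    (hne : u t ≠ 0) : IsEigenvalue a bc lam := by
  refine ⟨u, h.solvesHill hA zero_lt_one subset_rfl, ?_, t, ht, hne⟩
  rw [BoundaryCondition.holds_iff, h.derivWithin_fst zero_lt_one (by simp),
    h.derivWithin_fst zero_lt_one (by simp)]
  simpa [hA.map_zero, hA.map_one] using And.intro hl hr

lemma IsNonresonant.not_isEigenvalue (h : IsNonresonant a bc lam) : ¬ IsEigenvalue a bc lam :=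
  fun ⟨u, hu, hb, t, ht, hne⟩ => hne (h u hu hb t ht)

/-! ### Explicit pairs for the three problems and the identities between kernels. -/

namespace IsFundamental

variable {u₁ p₁ u₂ p₂ : ℝ → ℝ}

lemma isGreenPair_neumann (h : IsFundamental A μ u₁ p₁ u₂ p₂) (hne : p₁ 1 ≠ 0) :
    IsGreenPair A .neumann μ u₁ p₁ (fun t => p₂ 1 * u₁ t + -p₁ 1 * u₂ t)
      (fun t => p₂ 1 * p₁ t + -p₁ 1 * p₂ t) (-p₁ 1) where
  sol_left := h.sol₁
  sol_right := h.sol₁.lincomb h.sol₂ _ _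
  left := h.p₁_zero
  right := by simp only [BoundaryCondition.Right]; ring
  wronskian t ht := by linear_combination (-p₁ 1) * h.wronskian t ht
  wronskian_ne_zero := neg_ne_zero.2 hne

lemma isGreenPair_mixed1 (h : IsFundamental A μ u₁ p₁ u₂ p₂) (hne : u₁ 1 ≠ 0) :
    IsGreenPair A .mixed1 μ u₁ p₁ (fun t => -u₂ 1 * u₁ t + u₁ 1 * u₂ t)
      (fun t => -u₂ 1 * p₁ t + u₁ 1 * p₂ t) (u₁ 1) where
  sol_left := h.sol₁
  sol_right := h.sol₁.lincomb h.sol₂ _ _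
  left := h.p₁_zero
  right := by simp only [BoundaryCondition.Right]; ring
  wronskian t ht := by linear_combination u₁ 1 * h.wronskian t ht
  wronskian_ne_zero := hne

lemma isGreenPair_mixed2 (h : IsFundamental A μ u₁ p₁ u₂ p₂) (hne : p₂ 1 ≠ 0) :
    IsGreenPair A .mixed2 μ u₂ p₂ (fun t => p₂ 1 * u₁ t + -p₁ 1 * u₂ t)
      (fun t => p₂ 1 * p₁ t + -p₁ 1 * p₂ t) (-p₂ 1) where
  sol_left := h.sol₂
  sol_right := h.sol₁.lincomb h.sol₂ _ _
  left := h.u₂_zero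
  right := by simp only [BoundaryCondition.Right]; ring
  wronskian t ht := by linear_combination (-p₂ 1) * h.wronskian t ht
  wronskian_ne_zero := neg_ne_zero.2 hne

lemma p₁_one_ne_zero (hA : IsPrimitive a A m) (h : IsFundamental A (lam + m) u₁ p₁ u₂ p₂)
    (hn : IsNonresonant a .neumann lam) : p₁ 1 ≠ 0 := fun h0 =>
  hn.not_isEigenvalue (h.sol₁.isEigenvalue hA h.p₁_zero h0 (t := 0) (by simp) (by simp [h.u₁_zero]))

lemma u₁_one_ne_zero (hA : IsPrimitive a A m) (h : IsFundamental A (lam + m) u₁ p₁ u₂ p₂)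
    (hn : IsNonresonant a .mixed1 lam) : u₁ 1 ≠ 0 := fun h0 =>
  hn.not_isEigenvalue (h.sol₁.isEigenvalue hA h.p₁_zero h0 (t := 0) (by simp) (by simp [h.u₁_zero]))

lemma p₂_one_ne_zero (hA : IsPrimitive a A m) (h : IsFundamental A (lam + m) u₁ p₁ u₂ p₂)
    (hn : IsNonresonant a .mixed2 lam) : p₂ 1 ≠ 0 := fun h0 => by
  have hw := h.wronskian 1 (by simp)
  refine hn.not_isEigenvalue (h.sol₂.isEigenvalue hA h.u₂_zero h0 (t := 1) (by simp) fun h1 => ?_)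
  simp [h0, h1] at hw

/-- With `g` the common right factor, `u₂ / (-p₂ 1) - u₁ / (-p₁ 1) = g / (p₁ 1 * p₂ 1)`, so the
kernels differ by the symmetric product `g t * g s / (p₁ 1 * p₂ 1)`. -/
lemma green_mixed2_eq (h : IsFundamental A μ u₁ p₁ u₂ p₂) (hN : p₁ 1 ≠ 0) (h2 : p₂ 1 ≠ 0)
    {t s : ℝ} (ht : t ∈ Icc (0 : ℝ) 1) :
    green u₂ (fun t => p₂ 1 * u₁ t + -p₁ 1 * u₂ t) (-p₂ 1) t s =
      green u₁ (fun t => p₂ 1 * u₁ t + -p₁ 1 * u₂ t) (-p₁ 1) t s +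
        green u₁ (fun t => p₂ 1 * u₁ t + -p₁ 1 * u₂ t) (-p₁ 1) t 0 *
          ((p₂ 1 * u₁ s + -p₁ 1 * u₂ s) / -p₂ 1) := by
  rw [green_of_ge ht.1, h.u₁_zero]
  rcases le_total t s with hts | hts
  · rw [green_of_le hts, green_of_le hts]
    field_simp
    ring
  · rw [green_of_ge hts, green_of_ge hts]
    field_simp
    ring

/-- The left factor `u₁` is common, and the right factors divided by their Wronskians differ by a
multiple of `u₁`, so the difference is a constant times `u₁ t * u₁ s`. -/
lemma green_mixed1_eq (hN : p₁ 1 ≠ 0) (h1 : u₁ 1 ≠ 0)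
    {t s : ℝ} (ht : t ∈ Icc (0 : ℝ) 1) :
    green u₁ (fun t => -u₂ 1 * u₁ t + u₁ 1 * u₂ t) (u₁ 1) t s =
      green u₁ (fun t => p₂ 1 * u₁ t + -p₁ 1 * u₂ t) (-p₁ 1) t s -
        green u₁ (fun t => p₂ 1 * u₁ t + -p₁ 1 * u₂ t) (-p₁ 1) t 1 * (u₁ s / u₁ 1) := by
  rw [green_of_le ht.2]
  rcases le_total t s with hts | hts
  · rw [green_of_le hts, green_of_le hts]
    field_simp
    ring
  · rw [green_of_ge hts, green_of_ge hts]
    field_simp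
    ring

end IsFundamental

end HillGreen

/-! ### The main theorem. -/

theorem mainTheorem5 (a : ℝ → ℝ) (ha : IntegrableOn a (Icc (0 : ℝ) 1) volume) :
    -- nonresonant problems have a Green's function
    (∀ (bc : HillGreen.BoundaryCondition) (lam : ℝ), HillGreen.IsNonresonant a bc lam →
      ∃ G : ℝ → ℝ → ℝ, HillGreen.IsGreenFunction a bc lam G) ∧
    -- the identity relating `G_{M₂}` and `G_N`; here `d s = ∂ₜ G_{M₂}(0, s)`,
    -- extended continuously to `s = 0`
    (∀ lam : ℝ, HillGreen.IsNonresonant a .neumann lam → HillGreen.IsNonresonant a .mixed2 lam →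
      ∀ GN GM₂ : ℝ → ℝ → ℝ, HillGreen.IsGreenFunction a .neumann lam GN →
        HillGreen.IsGreenFunction a .mixed2 lam GM₂ →
        ∃ d : ℝ → ℝ, ContinuousOn d (Icc 0 1) ∧
          (∀ s ∈ Ioc (0 : ℝ) 1, HasDerivWithinAt (fun t => GM₂ t s) (d s) (Icc 0 1) 0) ∧
          ∀ t ∈ Icc (0 : ℝ) 1, ∀ s ∈ Icc (0 : ℝ) 1, GM₂ t s = GN t s + GN t 0 * d s) ∧
    -- the identity relating `G_{M₁}` and `G_N`; here `d s = ∂ₜ G_{M₁}(1, s)`,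
    -- extended continuously to `s = 1`
    (∀ lam : ℝ, HillGreen.IsNonresonant a .neumann lam → HillGreen.IsNonresonant a .mixed1 lam →
      ∀ GN GM₁ : ℝ → ℝ → ℝ, HillGreen.IsGreenFunction a .neumann lam GN →
        HillGreen.IsGreenFunction a .mixed1 lam GM₁ →
        ∃ d : ℝ → ℝ, ContinuousOn d (Icc 0 1) ∧
          (∀ s ∈ Ico (0 : ℝ) 1, HasDerivWithinAt (fun t => GM₁ t s) (d s) (Icc 0 1) 1) ∧
          ∀ t ∈ Icc (0 : ℝ) 1, ∀ s ∈ Icc (0 : ℝ) 1, GM₁ t s = GN t s - GN t 1 * d s) ∧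
    -- the first Neumann eigenvalue and the comparison below it
    ∃ lam₀ : ℝ, IsLeast {lam : ℝ | HillGreen.IsEigenvalue a .neumann lam} lam₀ ∧
      ∀ lam : ℝ, lam < lam₀ →
        HillGreen.IsNonresonant a .neumann lam ∧
        HillGreen.IsNonresonant a .mixed1 lam ∧
        HillGreen.IsNonresonant a .mixed2 lam ∧
        ∀ GN GM₁ GM₂ : ℝ → ℝ → ℝ, HillGreen.IsGreenFunction a .neumann lam GN →
          HillGreen.IsGreenFunction a .mixed1 lam GM₁ →
          HillGreen.IsGreenFunction a .mixed2 lam GM₂ →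
          (∀ t ∈ Ioc (0 : ℝ) 1, ∀ s ∈ Ioc (0 : ℝ) 1, GN t s < GM₂ t s ∧ GM₂ t s < 0) ∧
          (∀ t ∈ Ico (0 : ℝ) 1, ∀ s ∈ Ico (0 : ℝ) 1, GN t s < GM₁ t s ∧ GM₁ t s < 0) := by
  obtain ⟨A, m, hA⟩ := HillGreen.exists_isPrimitive ha
  have hAc := hA.continuousOn
  refine ⟨fun bc lam hn => ?_, fun lam hN hM GN GM₂ hGN hGM => ?_,
    fun lam hN hM GN GM₁ hGN hGM => ?_, ?_⟩
  · obtain ⟨u₁, p₁, u₂, p₂, h⟩ := HillGreen.exists_isFundamental hAc (lam + m)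
    cases bc with
    | neumann => exact ⟨_, (h.isGreenPair_neumann (h.p₁_one_ne_zero hA hn)).isGreenFunction hA⟩
    | mixed1 => exact ⟨_, (h.isGreenPair_mixed1 (h.u₁_one_ne_zero hA hn)).isGreenFunction hA⟩
    | mixed2 => exact ⟨_, (h.isGreenPair_mixed2 (h.p₂_one_ne_zero hA hn)).isGreenFunction hA⟩
  · obtain ⟨u₁, p₁, u₂, p₂, h⟩ := HillGreen.exists_isFundamental hAc (lam + m)
    have hp₁ := h.p₁_one_ne_zero hA hN
    have hp₂ := h.p₂_one_ne_zero hA hM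
    have eN := (h.isGreenPair_neumann hp₁).eq_green hA hGN
    have eM := (h.isGreenPair_mixed2 hp₂).eq_green hA hGM
    refine ⟨fun s => (p₂ 1 * u₁ s + -p₁ 1 * u₂ s) / -p₂ 1, ?_, fun s hs => ?_,
      fun t ht s hs => ?_⟩
    · exact (h.sol₁.lincomb h.sol₂ _ _).continuousOn_fst.div_const _
    · have hd := (h.isGreenPair_mixed2 hp₂).hasDerivWithinAt_green_zero hA hs.1
      rw [h.p₂_zero, one_mul] at hd
      exact hd.congr_of_mem (fun t ht => eM t ht s (Ioc_subset_Icc_self hs)) (by simp)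
    · rw [eM t ht s hs, eN t ht s hs, eN t ht 0 (by simp)]
      exact h.green_mixed2_eq hp₁ hp₂ ht
  · obtain ⟨u₁, p₁, u₂, p₂, h⟩ := HillGreen.exists_isFundamental hAc (lam + m)
    have hp₁ := h.p₁_one_ne_zero hA hN
    have hu₁ := h.u₁_one_ne_zero hA hM
    have eN := (h.isGreenPair_neumann hp₁).eq_green hA hGN
    have eM := (h.isGreenPair_mixed1 hu₁).eq_green hA hGM
    refine ⟨fun s => u₁ s / u₁ 1, h.sol₁.continuousOn_fst.div_const _, fun s hs => ?_,
      fun t ht s hs => ?_⟩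
    · have hd := (h.isGreenPair_mixed1 hu₁).hasDerivWithinAt_green_one hA hs.2
      have hw : -u₂ 1 * p₁ 1 + u₁ 1 * p₂ 1 = 1 := by
        linear_combination h.wronskian 1 (by simp)
      rw [hw, mul_one] at hd
      exact hd.congr_of_mem (fun t ht => eM t ht s (Ico_subset_Icc_self hs)) (by simp)
    · rw [eM t ht s hs, eN t ht s hs, eN t ht 1 (by simp)]
      exact HillGreen.IsFundamental.green_mixed1_eq hp₁ hu₁ ht
  · obtain ⟨μ₀, hlt, u, p, hs, hu0, hp0, hp1⟩ := HillGreen.exists_first_eigenvalue hAc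
    have key : ∀ lam : ℝ, lam < μ₀ - m → ∃ u₁ p₁ u₂ p₂ : ℝ → ℝ,
        HillGreen.IsFundamental A (lam + m) u₁ p₁ u₂ p₂ ∧
          (∀ t ∈ Icc (0 : ℝ) 1, 0 < u₁ t) ∧ 0 < p₁ 1 ∧ 0 < p₂ 1 := by
      intro lam hlam
      obtain ⟨u₁, p₁, u₂, p₂, h⟩ := HillGreen.exists_isFundamental hAc (lam + m)
      -- An intermediate `ν` lets the strict comparison apply to the given `u₁` itself, with no
      -- appeal to uniqueness.
      obtain ⟨ν, hν, hν'⟩ := exists_between (show lam + m < μ₀ by linarith)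
      obtain ⟨hpos, hp⟩ := HillGreen.pos_of_lt_of_mem_posSet (hlt ν hν') hν h.sol₁ h.u₁_zero
        h.p₁_zero
      have h0 := h.neumann_right_pos hpos hp (t := 0) (by simp)
      rw [h.u₁_zero, h.u₂_zero] at h0
      exact ⟨u₁, p₁, u₂, p₂, h, hpos, hp, by linarith⟩
    refine ⟨μ₀ - m, ⟨?_, fun lam hlam => ?_⟩, fun lam hlam => ?_⟩
    · refine HillGreen.IsQuasiSol.isEigenvalue (u := u) (p := p) hA (by rwa [sub_add_cancel]) hp0
        hp1 (t := 0) (by simp) (by simp [hu0])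
    · by_contra! hlt'
      obtain ⟨u₁, p₁, u₂, p₂, h, -, hp, -⟩ := key lam hlt'
      exact ((h.isGreenPair_neumann hp.ne').isNonresonant hA).not_isEigenvalue hlam
    · obtain ⟨u₁, p₁, u₂, p₂, h, hpos, hp₁, hp₂⟩ := key lam hlam
      have hu₁ := hpos 1 (by simp)
      have gN := h.isGreenPair_neumann hp₁.ne'
      have g1 := h.isGreenPair_mixed1 hu₁.ne'
      have g2 := h.isGreenPair_mixed2 hp₂.ne'
      refine ⟨gN.isNonresonant hA, g1.isNonresonant hA, g2.isNonresonant hA, ?_⟩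
      intro GN GM₁ GM₂ hGN hGM₁ hGM₂
      have hψ : ∀ t ∈ Icc (0 : ℝ) 1, 0 < p₂ 1 * u₁ t + -p₁ 1 * u₂ t := fun t ht => by
        linarith [h.neumann_right_pos hpos hp₁ ht]
      refine ⟨fun t ht s hs => ?_, fun t ht s hs => ?_⟩
      · have ht' := Ioc_subset_Icc_self ht
        have hs' := Ioc_subset_Icc_self hs
        rw [gN.eq_green hA hGN t ht' s hs', g2.eq_green hA hGM₂ t ht' s hs']
        constructor
        · rw [h.green_mixed2_eq hp₁.ne' hp₂.ne' ht', HillGreen.green_of_ge ht'.1, h.u₁_zero, one_mul]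
          -- The correction is a product of two negative factors, `GN t 0` and `∂ₜ GM₂ (0, s)`.
          exact lt_add_of_pos_right _ (mul_pos_of_neg_of_neg
            (div_neg_of_pos_of_neg (hψ t ht') (neg_neg_of_pos hp₁))
            (div_neg_of_pos_of_neg (hψ s hs') (neg_neg_of_pos hp₂)))
        · exact div_neg_of_pos_of_neg (mul_pos
            (h.u₂_pos hpos ⟨lt_min ht.1 hs.1, (min_le_left _ _).trans ht.2⟩)
            (hψ _ ⟨ht'.1.trans (le_max_left _ _), max_le ht.2 hs.2⟩)) (neg_neg_of_pos hp₂)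
      · have ht' := Ico_subset_Icc_self ht
        have hs' := Ico_subset_Icc_self hs
        rw [gN.eq_green hA hGN t ht' s hs', g1.eq_green hA hGM₁ t ht' s hs']
        constructor
        · rw [HillGreen.IsFundamental.green_mixed1_eq (p₁ := p₁) (p₂ := p₂) hp₁.ne' hu₁.ne' ht',
            HillGreen.green_of_le ht'.2]
          -- Here `GN t 1 < 0` while `∂ₜ GM₁ (1, s) = u₁ s / u₁ 1 > 0`.
          exact lt_sub_iff_add_lt.2 (add_lt_of_neg_right _ (mul_neg_of_neg_of_pos
            (div_neg_of_pos_of_neg (mul_pos (hpos t ht') (hψ 1 (by simp))) (neg_neg_of_pos hp₁))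
            (div_pos (hpos s hs') hu₁)))
        · have hmax := h.dirichlet_right_neg hpos (t := max t s)
            ⟨ht.1.trans (le_max_left _ _), max_lt ht.2 hs.2⟩
          refine div_neg_of_neg_of_pos (mul_neg_of_pos_of_neg
            (hpos _ ⟨le_min ht.1 hs.1, (min_le_left _ _).trans ht'.2⟩) ?_) hu₁
          linarith
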